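/- Let $G=(V,A)$ be a directed graph with $V=\{0,\dots,n-1\}$, let $R\subseteq V$ be a set of terminals and $r\in R$ a root. A \emph{Steiner arborescence} is a subgraph $T\subseteq G$ that contains all of $R$ and is an arborescence with root $r$ (the root $r$ has in-degree $0$ in $T$, every other vertex of $T$ has in-degree $1$ in $T$, and every vertex of $T$ is reachable from $r$ in $T$). Its cost is its number of arcs, and its Steiner vertices are the vertices in $V(T)\setminus R$. There is an algorithm (a single program for a random access machine with arithmetic on natural numbers) which, given $G$, $R$, $r$, a rational number $\varepsilon>0$ (as a reduced fraction) and an integer $p\ge 0$, always halts within $2^{p^2/\varepsilon}\cdot n^{O(1)}$ elementary steps, and which, whenever $G$ has a Steiner arborescence with at most $p$ Steiner vertices, outputs a Steiner arborescence $T$ of $G$ (possibly with more than $p$ Steiner vertices) such that $$|A(T)|\le(1+\varepsilon)\,|A(T')|\quad\text{for every Steiner arborescence } T'\subseteq G \text{ with } |V(T')\setminus R|\le p .$$ Moreover, if every elementary step is charged by the binary lengths of the numbers that it handles (the product of the lengths of the two operands for a multiplication or a division, the sum of the lengths otherwise), then the running time is at most $2^{p^2/\varepsilon}\cdot N^{O(1)}$,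 where $N$ is $n$ plus the binary lengths of $p$ and of the numerator and the denominator of $\varepsilon$. The constants in both bounds are absolute. If no Steiner arborescence with at most $p$ Steiner vertices exists, the output may be arbitrary. -/

import Mathlib

/-! ### Steiner arborescences in unweighted directed graphs -/

/-- A finite directed graph given by its vertex set and its arc set. -/
structure ArcGraph (V : Type*) where
  verts : Finset V
  arcs : Finset (V × V)

namespace ArcGraph

variable {V : Type*}

/-- `T` is a subgraph of the directed graph `G`. -/
def IsSubgraphOf (T : ArcGraph V) (G : Digraph V) : Prop :=
  ∀ a ∈ T.arcs, a.1 ∈ T.verts ∧ a.2 ∈ T.verts ∧ G.Adj a.1 a.2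

/-- `T` is an arborescence with root `r`: the root has in-degree zero, every other vertex of `T`
has in-degree one, and every vertex of `T` is reachable from `r` along arcs of `T`. -/
structure IsArborescence (T : ArcGraph V) (r : V) : Prop where
  root_mem : r ∈ T.verts
  root_inDegree : ∀ u, (u, r) ∉ T.arcs
  inDegree : ∀ v ∈ T.verts, v ≠ r → ∃! u, (u, v) ∈ T.arcs
  reachable : ∀ v ∈ T.verts, Relation.ReflTransGen (fun u w => (u, w) ∈ T.arcs) r v

/-- `T` is a Steiner arborescence of `G` for the terminal set `R` and the root `r`. -/
structure IsSteinerArborescence (T : ArcGraph V) (G : Digraph V) (R : Finset V) (r : V) :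
    Prop where
  subgraph : T.IsSubgraphOf G
  arborescence : T.IsArborescence r
  terminals : R ⊆ T.verts

/-- The cost of an unweighted graph: the number of its arcs. -/
def cost (T : ArcGraph V) : ℕ := T.arcs.card

/-- The number of Steiner vertices (non-terminals) of `T`. -/
def steinerCount [DecidableEq V] (T : ArcGraph V) (R : Finset V) : ℕ := (T.verts \ R).card

end ArcGraph

/-! ### Random access machines, with structured programs

A machine has finitely many named registers and finitely many named arrays (a program is a finite
term, so it mentions only finitely many names), all holding natural numbers. The array cells are
addressed by computed indices. -/

namespace RAM

/-- Memory contents. -/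
structure Store where
  /-- the register with a given name -/
  reg : ℕ → ℕ
  /-- the cell of the array with a given name at a given index -/
  arr : ℕ → ℕ → ℕ

/-- The arithmetic operations. Subtraction is truncated, and comparisons return `1` or `0`. -/
inductive Op
  | add | sub | mul | div | mod | lt | eq

/-- The value of an operation. -/
def Op.eval : Op → ℕ → ℕ → ℕ
  | .add, x, y => x + y
  | .sub, x, y => x - y
  | .mul, x, y => x * y
  | .div, x, y => x / y
  | .mod, x, y => x % y
  | .lt, x, y => if x < y then 1 else 0
  | .eq, x, y => if x = y then 1 else 0

/-- The price of an operation, when handling the number `x` is priced `ℓ x`. -/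
def Op.price (ℓ : ℕ → ℕ) : Op → ℕ → ℕ → ℕ
  | .mul, x, y => ℓ x * ℓ y
  | .div, x, y => ℓ x * ℓ y
  | .mod, x, y => ℓ x * ℓ y
  | _, x, y => ℓ x + ℓ y

/-- Expressions: constants, registers, array cells, and operations. -/
inductive Term
  | const (k : ℕ)
  | reg (x : ℕ)
  | cell (a : ℕ) (i : Term)
  | op (o : Op) (e₁ e₂ : Term)

/-- The value of an expression. -/
def Term.eval (s : Store) : Term → ℕ
  | .const k => k
  | .reg x => s.reg x
  | .cell a i => s.arr a (i.eval s)
  | .op o e₁ e₂ => o.eval (e₁.eval s) (e₂.eval s)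

/-- The time for evaluating an expression. Reading a cell is charged for the index and for the
value read. -/
def Term.price (ℓ : ℕ → ℕ) (s : Store) : Term → ℕ
  | .const k => ℓ k
  | .reg x => ℓ (s.reg x)
  | .cell a i => i.price ℓ s + ℓ (i.eval s) + ℓ (s.arr a (i.eval s))
  | .op o e₁ e₂ => e₁.price ℓ s + e₂.price ℓ s + o.price ℓ (e₁.eval s) (e₂.eval s)

/-- Programs. A test succeeds when its value is not `0`. -/
inductive Program
  | skip
  | assign (x : ℕ) (e : Term)
  | store (a : ℕ) (i e : Term)
  | seq (c₁ c₂ : Program)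
  | ite (e : Term) (c₁ c₂ : Program)
  | loop (e : Term) (c : Program)

/-- Overwrite a register. -/
def Store.setReg (s : Store) (x v : ℕ) : Store :=
  { s with reg := Function.update s.reg x v }

/-- Overwrite an array cell. -/
def Store.setCell (s : Store) (a i v : ℕ) : Store :=
  { s with arr := Function.update s.arr a (Function.update (s.arr a) i v) }

/-- `Runs ℓ c s t s'`: the program `c`, started in `s`, halts in `s'` after time `t`, when handling
the number `x` is priced `ℓ x`. -/
inductive Runs (ℓ : ℕ → ℕ) : Program → Store → ℕ → Store → Prop
  | skip (s : Store) : Runs ℓ .skip s 1 s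
  | assign (s : Store) (x : ℕ) (e : Term) :
      Runs ℓ (.assign x e) s (e.price ℓ s + ℓ (e.eval s)) (s.setReg x (e.eval s))
  | store (s : Store) (a : ℕ) (i e : Term) :
      Runs ℓ (.store a i e) s (i.price ℓ s + e.price ℓ s + ℓ (i.eval s) + ℓ (e.eval s))
        (s.setCell a (i.eval s) (e.eval s))
  | seq {c₁ c₂ : Program} {s s₁ s₂ : Store} {t₁ t₂ : ℕ} :
      Runs ℓ c₁ s t₁ s₁ → Runs ℓ c₂ s₁ t₂ s₂ → Runs ℓ (.seq c₁ c₂) s (t₁ + t₂) s₂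
  | ite_true {e : Term} {c₁ c₂ : Program} {s s' : Store} {t : ℕ} :
      e.eval s ≠ 0 → Runs ℓ c₁ s t s' → Runs ℓ (.ite e c₁ c₂) s (e.price ℓ s + 1 + t) s'
  | ite_false {e : Term} {c₁ c₂ : Program} {s s' : Store} {t : ℕ} :
      e.eval s = 0 → Runs ℓ c₂ s t s' → Runs ℓ (.ite e c₁ c₂) s (e.price ℓ s + 1 + t) s'
  | loop_stop {e : Term} {c : Program} {s : Store} :
      e.eval s = 0 → Runs ℓ (.loop e c) s (e.price ℓ s + 1) s
  | loop_step {e : Term} {c : Program} {s s₁ s₂ : Store} {t₁ t₂ : ℕ} :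
      e.eval s ≠ 0 → Runs ℓ c s t₁ s₁ → Runs ℓ (.loop e c) s₁ t₂ s₂ →
      Runs ℓ (.loop e c) s (e.price ℓ s + 1 + t₁ + t₂) s₂

/-- The uniform price: every number costs `1`. Under it, time counts elementary steps. -/
def unitPrice : ℕ → ℕ := fun _ => 1

/-- The logarithmic price: a number costs its length in binary, plus one. -/
def bitPrice : ℕ → ℕ := fun x => x.size + 1

end RAM

/-! ### Input and output conventions -/

open Classical in
/-- The initial store for an instance on the vertices `0, …, n - 1`. Registers `0, …, 4` hold `n`,
the root, `p`, and the numerator and the denominator of `ε` in lowest terms. Array `0` holds the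
adjacency matrix row by row, array `1` the characteristic vector of the terminal set. Everything
else is `0`. -/
noncomputable def inputStore {n : ℕ} (G : Digraph (Fin n)) (R : Finset (Fin n)) (r : Fin n)
    (p : ℕ) (ε : ℚ) : RAM.Store where
  reg := fun x =>
    match x with
    | 0 => n
    | 1 => r
    | 2 => p
    | 3 => ε.num.toNat
    | 4 => ε.den
    | _ => 0
  arr := fun a i =>
    match a with
    | 0 => if ∃ u v : Fin n, i = u * n + v ∧ G.Adj u v then 1 else 0
    | 1 => if ∃ v ∈ R, i = (v : ℕ) then 1 else 0
    | _ => 0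

/-- The number of vertices plus the lengths in binary of `p` and of the numerator and the
denominator of `ε`. -/
def inputLength (n p : ℕ) (ε : ℚ) : ℕ := n + p.size + ε.num.toNat.size + ε.den.size

/-- The store `s` holds `T` as output: array `2` holds the adjacency matrix of `T` row by row,
where an entry other than `0` stands for an arc. (For an arborescence with a given root, the arcs
determine the vertices.) -/
def OutputIs {n : ℕ} (s : RAM.Store) (T : ArcGraph (Fin n)) : Prop :=
  ∀ u v : Fin n, s.arr 2 (u * n + v) ≠ 0 ↔ (u, v) ∈ T.arcs

/-! ### A timed program logic for the random access machine -/

namespace RAM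

/-! Write ε = a/b and measure solutions by vertices, one more than arcs in an arborescence. It
suffices to find a small vertex set in which `r` reaches all terminals; a search inside it then
yields the tree.

The program tries every vertex `x` as an additional terminal. For each guess a greedy phase visits
every vertex `v` once. It finds a smallest set `P` of Steiner vertices by which `r` reaches `v`,
terminals being free, and buys `P` if |P| is at most ε times the number of uncovered terminals
reached in this way. So purchases are charged to newly covered terminals at rate ε. Let `U` be the
set of terminals left uncovered. A vertex that can be reached with i Steiner vertices then leads,
through terminals alone, to at most i/ε elements of `U` (`GreedyInv.buy`, `GreedyInv.pass`).

Suppose a competitor has q Steiner vertices besides the guess. They can be ordered so that the i-th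
is reached with i of them, and every element of `U` hangs from one of them by a walk through
terminals. Summation gives |U| ≤ q(q+1)/(2ε) (`two_mul_sum_weight_le`, `two_mul_card_uncovered_le`).
If `x` is a Steiner vertex of the competitor, then q ≤ p - 1 and 2|U| ≤ p²/ε; the guess is what
turns p(p+1) into p². Guesses with larger `U` are abandoned.

An exact dynamic program over subsets of `U` then connects `U` with at most q further Steiner
vertices. It tries all pairs of subsets, hence the factor 4^|U| ≤ 2^(p²/ε) (`TableComplete.succ`,
`table_optimal`, `RAM.steiner_spec`). With R' = R ∪ {x}, the total is at most |R'| + ε(|R'| - 1) + q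
vertices, which gives the ratio 1 + ε (`MainInv.card_le`).

Both time bounds come from a single count of primitive commands. Stored numbers stay below some M
and expressions have bounded size, so each command costs at most a constant times the squared price
of M^40 (`RAM.Triple`). -/

instance : Add Term := ⟨Term.op .add⟩
instance : Sub Term := ⟨Term.op .sub⟩
instance : Mul Term := ⟨Term.op .mul⟩
instance : Div Term := ⟨Term.op .div⟩
instance : Mod Term := ⟨Term.op .mod⟩
instance (k : ℕ) : OfNat Term k := ⟨Term.const k⟩

/-- The expression testing `e₁ < e₂`. -/
def Term.less (e₁ e₂ : Term) : Term := .op .lt e₁ e₂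

/-- The expression testing `e₁ = e₂`. -/
def Term.same (e₁ e₂ : Term) : Term := .op .eq e₁ e₂

@[simp] theorem Term.eval_zero (s : Store) : (0 : Term).eval s = 0 := rfl
@[simp] theorem Term.eval_one (s : Store) : (1 : Term).eval s = 1 := rfl
@[simp] theorem Term.eval_two (s : Store) : (2 : Term).eval s = 2 := rfl
@[simp] theorem Term.eval_reg (s : Store) (x : ℕ) : (Term.reg x).eval s = s.reg x := rfl
@[simp] theorem Term.eval_cell (s : Store) (a : ℕ) (i : Term) :
    (Term.cell a i).eval s = s.arr a (i.eval s) := rfl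
@[simp] theorem Term.eval_add (s : Store) (a b : Term) :
    (a + b).eval s = a.eval s + b.eval s := rfl
@[simp] theorem Term.eval_sub (s : Store) (a b : Term) :
    (a - b).eval s = a.eval s - b.eval s := rfl
@[simp] theorem Term.eval_mul (s : Store) (a b : Term) :
    (a * b).eval s = a.eval s * b.eval s := rfl
@[simp] theorem Term.eval_div (s : Store) (a b : Term) :
    (a / b).eval s = a.eval s / b.eval s := rfl
@[simp] theorem Term.eval_mod (s : Store) (a b : Term) :
    (a % b).eval s = a.eval s % b.eval s := rfl
@[simp] theorem Term.eval_less (s : Store) (a b : Term) :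
    (a.less b).eval s = if a.eval s < b.eval s then 1 else 0 := rfl
@[simp] theorem Term.eval_same (s : Store) (a b : Term) :
    (a.same b).eval s = if a.eval s = b.eval s then 1 else 0 := rfl

@[simp] theorem Store.setReg_reg (s : Store) (x v y : ℕ) :
    (s.setReg x v).reg y = if y = x then v else s.reg y := by
  simp [Store.setReg, Function.update_apply]
@[simp] theorem Store.setReg_arr (s : Store) (x v : ℕ) : (s.setReg x v).arr = s.arr := rfl
@[simp] theorem Store.setCell_reg (s : Store) (a i v : ℕ) : (s.setCell a i v).reg = s.reg := rfl
@[simp] theorem Store.setCell_arr (s : Store) (a i v b j : ℕ) :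
    (s.setCell a i v).arr b j = if b = a ∧ j = i then v else s.arr b j := by
  by_cases hb : b = a
  · subst hb; simp [Store.setCell, Function.update_apply]
  · simp [Store.setCell, hb]

/-- The number of nodes of an expression. -/
def Term.nodes : Term → ℕ
  | .const _ => 1
  | .reg _ => 1
  | .cell _ i => i.nodes + 1
  | .op _ e₁ e₂ => e₁.nodes + e₂.nodes + 1

/-- The largest constant of an expression. -/
def Term.maxConst : Term → ℕ
  | .const k => k
  | .reg _ => 0
  | .cell _ i => i.maxConst
  | .op _ e₁ e₂ => max e₁.maxConst e₂.maxConst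

/-- The expressions that occur in our programs are small. -/
def Term.Small (e : Term) : Prop := e.nodes ≤ 40 ∧ e.maxConst ≤ 2

instance (e : Term) : Decidable e.Small := inferInstanceAs (Decidable (_ ∧ _))

theorem Term.small_of_ble {e : Term} (h₁ : e.nodes.ble 40 = true) (h₂ : e.maxConst.ble 2 = true) :
    e.Small := ⟨Nat.le_of_ble_eq_true h₁, Nat.le_of_ble_eq_true h₂⟩

/-- All numbers in the store are at most `M`. -/
structure Store.Bdd (s : Store) (M : ℕ) : Prop where
  two_le : 2 ≤ M
  reg : ∀ x, s.reg x ≤ M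
  arr : ∀ a i, s.arr a i ≤ M

theorem Store.Bdd.setReg {s : Store} {M x v : ℕ} (h : s.Bdd M) (hv : v ≤ M) :
    (s.setReg x v).Bdd M :=
  ⟨h.two_le, fun y => by rw [Store.setReg_reg]; split_ifs; exacts [hv, h.reg y], h.arr⟩

theorem Store.Bdd.setCell {s : Store} {M a i v : ℕ} (h : s.Bdd M) (hv : v ≤ M) :
    (s.setCell a i v).Bdd M :=
  ⟨h.two_le, h.reg, fun b j => by rw [Store.setCell_arr]; split_ifs; exacts [hv, h.arr b j]⟩

theorem Term.nodes_pos (e : Term) : 1 ≤ e.nodes := by cases e <;> simp [Term.nodes]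

/-- Products add the exponents, and a sum loses at most a factor 2 ≤ M, which the node of the
operation pays for. Constants are restricted to 2 because M is only known to be at least 2. -/
theorem Term.eval_le {s : Store} {M : ℕ} (h : s.Bdd M) (e : Term) (he : e.maxConst ≤ 2) :
    e.eval s ≤ M ^ e.nodes := by
  have h2 := h.two_le
  induction e with
  | const k =>
    simp only [Term.maxConst] at he
    simpa [Term.eval, Term.nodes] using he.trans h2
  | reg x => simpa [Term.nodes] using h.reg x
  | cell a i _ => exact (h.arr _ _).trans (Nat.le_self_pow (by simp [Term.nodes]) M)
  | op o e₁ e₂ ih₁ ih₂ =>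
    simp only [Term.maxConst, max_le_iff] at he
    specialize ih₁ he.1
    specialize ih₂ he.2
    have n₁ := e₁.nodes_pos
    have n₂ := e₂.nodes_pos
    have hM : 1 ≤ M := by omega
    have m₁ : M ^ e₁.nodes ≤ M ^ (e₁.nodes + e₂.nodes) := Nat.pow_le_pow_right hM (by omega)
    have m₂ : M ^ e₂.nodes ≤ M ^ (e₁.nodes + e₂.nodes) := Nat.pow_le_pow_right hM (by omega)
    have m₃ : M ^ (e₁.nodes + e₂.nodes) ≤ M ^ (e₁.nodes + e₂.nodes + 1) :=
      Nat.pow_le_pow_right hM (by omega)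
    have m₀ : 1 ≤ M ^ (e₁.nodes + e₂.nodes + 1) := Nat.one_le_pow _ _ hM
    have m₄ : 2 * M ^ (e₁.nodes + e₂.nodes) ≤ M ^ (e₁.nodes + e₂.nodes + 1) := by
      rw [pow_succ, mul_comm]; exact Nat.mul_le_mul_left _ h2
    simp only [Term.eval, Term.nodes]
    cases o <;> simp only [Op.eval]
    · omega
    · omega
    · refine (Nat.mul_le_mul ih₁ ih₂).trans ?_
      rw [← pow_add]; exact m₃
    · exact (Nat.div_le_self _ _).trans (by omega)
    · exact (Nat.mod_le _ _).trans (by omega)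
    · split_ifs <;> omega
    · split_ifs <;> omega

/-- The square stems from multiplication and division, whose price is a product. The exponent `m` is
kept apart from the node count so that all subexpressions are measured against the same M^m in the
induction. -/
theorem Term.price_le {ℓ : ℕ → ℕ} (hℓ : Monotone ℓ) {s : Store} {M m : ℕ}
    (h : s.Bdd M) (e : Term) (he : e.maxConst ≤ 2) (hm : e.nodes ≤ m) :
    e.price ℓ s ≤ 2 * e.nodes * ℓ (M ^ m) ^ 2 := by
  have hM : 1 ≤ M := by have := h.two_le; omega
  have hL : ∀ e : Term, e.maxConst ≤ 2 → e.nodes ≤ m → ℓ (e.eval s) ≤ ℓ (M ^ m) := fun e h₁ h₂ =>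
    hℓ ((e.eval_le h h₁).trans (Nat.pow_le_pow_right hM h₂))
  have hsq : ℓ (M ^ m) ≤ ℓ (M ^ m) ^ 2 := Nat.le_self_pow (by simp) _
  induction e with
  | const k => have := hL _ he hm; simp only [Term.eval, Term.price, Term.nodes] at *; omega
  | reg x => have := hL _ he hm; simp only [Term.eval, Term.price, Term.nodes] at *; omega
  | cell a i ih =>
    have h₁ := hL _ he hm
    simp only [Term.maxConst, Term.nodes] at he hm
    have h₂ := hL i he (by omega)
    have h₃ := ih he (by omega)
    simp only [Term.eval, Term.price, Term.nodes] at *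
    nlinarith
  | op o e₁ e₂ ih₁ ih₂ =>
    simp only [Term.maxConst, Term.nodes, max_le_iff] at he hm
    have h₁ := hL e₁ he.1 (by omega)
    have h₂ := hL e₂ he.2 (by omega)
    have h₃ := ih₁ he.1 (by omega)
    have h₄ := ih₂ he.2 (by omega)
    have h₅ : ℓ (e₁.eval s) * ℓ (e₂.eval s) ≤ ℓ (M ^ m) ^ 2 := by
      rw [sq]; exact Nat.mul_le_mul h₁ h₂
    have h₆ : o.price ℓ (e₁.eval s) (e₂.eval s) ≤ 2 * ℓ (M ^ m) ^ 2 := by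
      cases o <;> simp only [Op.price] <;> omega
    simp only [Term.price, Term.nodes]
    nlinarith

/-- The registers that a program may overwrite. -/
def Program.regs : Program → List ℕ
  | .skip => []
  | .assign x _ => [x]
  | .store _ _ _ => []
  | .seq c₁ c₂ => c₁.regs ++ c₂.regs
  | .ite _ c₁ c₂ => c₁.regs ++ c₂.regs
  | .loop _ c => c.regs

/-- The arrays that a program may overwrite. -/
def Program.arrs : Program → List ℕ
  | .skip => []
  | .assign _ _ => []
  | .store a _ _ => [a]
  | .seq c₁ c₂ => c₁.arrs ++ c₂.arrs
  | .ite _ c₁ c₂ => c₁.arrs ++ c₂.arrs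
  | .loop _ c => c.arrs

/-- The stores `s` and `s'` agree on everything that the program `c` does not overwrite. -/
structure Frame (c : Program) (s s' : Store) : Prop where
  reg : ∀ x, x ∉ c.regs → s'.reg x = s.reg x
  arr : ∀ a, a ∉ c.arrs → s'.arr a = s.arr a

/-- Names of registers and arrays are syntactic, so preservation of untouched data reduces to list
membership and need not be part of any specification. -/
theorem Runs.frame {ℓ : ℕ → ℕ} {c : Program} {s s' : Store} {t : ℕ} (h : Runs ℓ c s t s') :
    Frame c s s' := by
  induction h with
  | skip => exact ⟨fun _ _ => rfl, fun _ _ => rfl⟩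
  | assign s x e =>
    refine ⟨fun y hy => ?_, fun _ _ => rfl⟩
    simp only [Program.regs, List.mem_singleton] at hy
    simp [hy]
  | store s a i e =>
    refine ⟨fun _ _ => rfl, fun b hb => ?_⟩
    simp only [Program.arrs, List.mem_singleton] at hb
    funext j; simp [hb]
  | seq _ _ ih₁ ih₂ =>
    refine ⟨fun x hx => ?_, fun a ha => ?_⟩
    · simp only [Program.regs, List.mem_append, not_or] at hx
      rw [ih₂.reg x hx.2, ih₁.reg x hx.1]
    · simp only [Program.arrs, List.mem_append, not_or] at ha
      rw [ih₂.arr a ha.2, ih₁.arr a ha.1]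
  | ite_true _ _ ih =>
    refine ⟨fun x hx => ?_, fun a ha => ?_⟩
    · simp only [Program.regs, List.mem_append, not_or] at hx
      exact ih.reg x hx.1
    · simp only [Program.arrs, List.mem_append, not_or] at ha
      exact ih.arr a ha.1
  | ite_false _ _ ih =>
    refine ⟨fun x hx => ?_, fun a ha => ?_⟩
    · simp only [Program.regs, List.mem_append, not_or] at hx
      exact ih.reg x hx.2
    · simp only [Program.arrs, List.mem_append, not_or] at ha
      exact ih.arr a ha.2
  | loop_stop => exact ⟨fun _ _ => rfl, fun _ _ => rfl⟩
  | loop_step _ _ _ ih₁ ih₂ =>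
    exact ⟨fun x hx => by rw [ih₂.reg x hx, ih₁.reg x hx],
      fun a ha => by rw [ih₂.arr a ha, ih₁.arr a ha]⟩

/-- Started in `s`, with all numbers at most `M`, the program `c` halts in a store that satisfies
`Q`, and in which all numbers are still at most `M`. The time is at most `k` times the price of a
primitive command, simultaneously for all monotone prices. -/
def Triple (M : ℕ) (c : Program) (s : Store) (k : ℕ) (Q : Store → Prop) : Prop :=
  s.Bdd M → ∃ s', s'.Bdd M ∧ Q s' ∧ ∀ ℓ : ℕ → ℕ, Monotone ℓ → (∀ x, 1 ≤ ℓ x) →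
    ∃ t, Runs ℓ c s t s' ∧ t ≤ k * (200 * ℓ (M ^ 40) ^ 2)

/-! ### Timed Hoare rules for the commands -/

section Triple

variable {M k k' k₁ k₂ : ℕ} {c c₁ c₂ : Program} {s : Store} {Q Q' : Store → Prop} {e e' : Term}

theorem Triple.of_bdd (h : s.Bdd M → Triple M c s k Q) : Triple M c s k Q := fun hs => h hs hs

theorem Triple.mono (h : Triple M c s k Q) (hk : k ≤ k') (hQ : ∀ s', Q s' → Q' s') :
    Triple M c s k' Q' := fun hs => by
  obtain ⟨s', b, q, r⟩ := h hs
  refine ⟨s', b, hQ _ q, fun ℓ h₁ h₂ => ?_⟩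
  obtain ⟨t, ht, hl⟩ := r ℓ h₁ h₂
  exact ⟨t, ht, hl.trans (Nat.mul_le_mul_right _ hk)⟩

theorem Triple.frame (h : Triple M c s k Q) : Triple M c s k (fun s' => Frame c s s' ∧ Q s') :=
  fun hs => by
    obtain ⟨s', b, q, r⟩ := h hs
    -- The frame property needs an actual run, which any admissible price supplies.
    obtain ⟨t, ht, -⟩ := r unitPrice (fun _ _ _ => le_rfl) (fun _ => le_rfl)
    exact ⟨s', b, ⟨ht.frame, q⟩, r⟩

theorem Triple.seq (h₁ : Triple M c₁ s k₁ Q')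
    (h₂ : ∀ s', Frame c₁ s s' → Q' s' → Triple M c₂ s' k₂ Q) :
    Triple M (.seq c₁ c₂) s (k₁ + k₂) Q := fun hs => by
  obtain ⟨s₁, b₁, ⟨f, q₁⟩, r₁⟩ := h₁.frame hs
  obtain ⟨s₂, b₂, q₂, r₂⟩ := h₂ s₁ f q₁ b₁
  refine ⟨s₂, b₂, q₂, fun ℓ m p => ?_⟩
  obtain ⟨t₁, h₁, l₁⟩ := r₁ ℓ m p
  obtain ⟨t₂, h₂, l₂⟩ := r₂ ℓ m p
  exact ⟨_, h₁.seq h₂, by rw [add_mul]; omega⟩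

theorem Triple.skip (h : Q s) : Triple M .skip s 1 Q := fun hs =>
  ⟨s, hs, h, fun ℓ _ p => ⟨1, .skip s, by have := Nat.one_le_pow 2 _ (p (M ^ 40)); omega⟩⟩

theorem Term.Small.price_le (he : e.Small) {ℓ : ℕ → ℕ} (hℓ : Monotone ℓ)
    (h : s.Bdd M) : e.price ℓ s ≤ 80 * ℓ (M ^ 40) ^ 2 :=
  (e.price_le hℓ h he.2 he.1).trans
    (Nat.mul_le_mul_right _ (by have := he.1; omega))

theorem Term.Small.eval_le (he : e.Small) {ℓ : ℕ → ℕ} (hℓ : Monotone ℓ)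
    (h : s.Bdd M) : ℓ (e.eval s) ≤ ℓ (M ^ 40) ^ 2 :=
  (hℓ ((e.eval_le h he.2).trans (Nat.pow_le_pow_right (by have := h.two_le; omega) he.1))).trans
    (Nat.le_self_pow (by simp) _)

/-- Only the stored result has to stay below M; intermediate values of `e` may be as large as M^40.
-/
theorem Triple.assign {x : ℕ} (he : e.Small) (hv : s.Bdd M → e.eval s ≤ M)
    (h : Q (s.setReg x (e.eval s))) : Triple M (.assign x e) s 1 Q := fun hs =>
  ⟨_, hs.setReg (hv hs), h, fun ℓ m p => ⟨_, .assign s x e, by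
    have h₁ := he.price_le m hs
    have h₂ := he.eval_le m hs
    omega⟩⟩

theorem Triple.store {a : ℕ} (he' : e'.Small) (he : e.Small) (hv : s.Bdd M → e.eval s ≤ M)
    (h : Q (s.setCell a (e'.eval s) (e.eval s))) : Triple M (.store a e' e) s 1 Q := fun hs =>
  ⟨_, hs.setCell (hv hs), h, fun ℓ m p => ⟨_, .store s a e' e, by
    -- This is the dearest command: two expressions at 80 and two values at 1, within the allowance
    -- of 200 in `Triple`.
    have h₁ := he.price_le m hs
    have h₂ := he.eval_le m hs
    have h₃ := he'.price_le m hs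
    have h₄ := he'.eval_le m hs
    omega⟩⟩

theorem Triple.ite (he : e.Small) (h₁ : e.eval s ≠ 0 → Triple M c₁ s k Q)
    (h₂ : e.eval s = 0 → Triple M c₂ s k Q) : Triple M (.ite e c₁ c₂) s (k + 1) Q := fun hs => by
  by_cases h : e.eval s = 0
  · obtain ⟨s', b, q, r⟩ := h₂ h hs
    refine ⟨s', b, q, fun ℓ m p => ?_⟩
    obtain ⟨t, ht, hl⟩ := r ℓ m p
    refine ⟨_, .ite_false h ht, ?_⟩
    have h₁ := he.price_le m hs
    have := Nat.one_le_pow 2 _ (p (M ^ 40))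
    rw [add_mul]; omega
  · obtain ⟨s', b, q, r⟩ := h₁ h hs
    refine ⟨s', b, q, fun ℓ m p => ?_⟩
    obtain ⟨t, ht, hl⟩ := r ℓ m p
    refine ⟨_, .ite_true h ht, ?_⟩
    have h₁ := he.price_le m hs
    have := Nat.one_le_pow 2 _ (p (M ^ 40))
    rw [add_mul]; omega

theorem Triple.loop_exit (he : e.Small) (h₀ : e.eval s = 0) (h : Q s) :
    Triple M (.loop e c) s 1 Q := fun hs =>
  ⟨s, hs, h, fun ℓ m p => ⟨_, Runs.loop_stop h₀, by
    have h₁ := he.price_le m hs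
    have := Nat.one_le_pow 2 _ (p (M ^ 40))
    omega⟩⟩

theorem Triple.loop_step (he : e.Small) (h₀ : e.eval s ≠ 0) (h₁ : Triple M c s k₁ Q')
    (h₂ : ∀ s', Frame c s s' → Q' s' → Triple M (.loop e c) s' k₂ Q) :
    Triple M (.loop e c) s (k₁ + k₂ + 1) Q := fun hs => by
  obtain ⟨s₁, b₁, ⟨f, q₁⟩, r₁⟩ := h₁.frame hs
  obtain ⟨s₂, b₂, q₂, r₂⟩ := h₂ s₁ f q₁ b₁
  refine ⟨s₂, b₂, q₂, fun ℓ m p => ?_⟩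
  obtain ⟨t₁, h₁, l₁⟩ := r₁ ℓ m p
  obtain ⟨t₂, h₂, l₂⟩ := r₂ ℓ m p
  refine ⟨_, .loop_step h₀ h₁ h₂, ?_⟩
  have h₃ := he.price_le m hs
  have := Nat.one_le_pow 2 _ (p (M ^ 40))
  simp only [add_mul]; omega

end Triple

/-- Run the program `c` for `i = 0, 1, …` below the value of the register `y`. -/
def forLoop (i y : ℕ) (c : Program) : Program :=
  .seq (.assign i 0)
    (.loop ((Term.reg i).less (.reg y)) (.seq c (.assign i (.reg i + 1))))

/-- The rule for counting loops. The invariant must not depend on the counter, which the body must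
not overwrite. -/
theorem Triple.forLoop {M i y N k : ℕ} {c : Program} {s : Store} (I : ℕ → Store → Prop)
    (hi : i ∉ c.regs) (hy : y ∉ c.regs) (hyi : y ≠ i) (hN : s.reg y = N)
    (hI : ∀ j s v, I j s → I j (s.setReg i v)) (h₀ : I 0 s)
    (hc : ∀ j < N, ∀ s', s'.reg i = j → (∀ x, x ≠ i → x ∉ c.regs → s'.reg x = s.reg x) →
      (∀ a, a ∉ c.arrs → s'.arr a = s.arr a) → I j s' → Triple M c s' k (I (j + 1))) :
    Triple M (forLoop i y c) s (N * (k + 2) + 2) (I N) := by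
  have main : ∀ m j s', j + m = N → s'.reg i = j →
      (∀ x, x ≠ i → x ∉ c.regs → s'.reg x = s.reg x) →
      (∀ a, a ∉ c.arrs → s'.arr a = s.arr a) → I j s' →
      Triple M (.loop ((Term.reg i).less (.reg y)) (.seq c (.assign i (.reg i + 1)))) s'
        (m * (k + 2) + 1) (I N) := by
    intro m
    induction m with
    | zero =>
      intro j s' hj h₁ h₂ h₃ h₄
      obtain rfl : j = N := by omega
      refine (Triple.loop_exit (Term.small_of_ble rfl rfl) ?_
        h₄).mono (by omega) (fun _ h => h)
      simp [h₁, h₂ y hyi hy, hN]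
    | succ m ih =>
      intro j s' hj h₁ h₂ h₃ h₄
      have hjy : j < s'.reg y := by rw [h₂ y hyi hy, hN]; omega
      refine Triple.mono (k := (k + 1) + (m * (k + 2) + 1) + 1) (Q := I N) ?_
        (by rw [Nat.add_mul]; omega) (fun _ h => h)
      refine Triple.loop_step (Q' := fun s'' => s''.reg i = j + 1 ∧ I (j + 1) s'') (Term.small_of_ble rfl rfl)
        (by simp [h₁, hjy]) ?_ ?_
      · refine Triple.seq (hc j (by omega) s' h₁ h₂ h₃ h₄) fun s'' f q => ?_
        have e₁ : s''.reg i = j := by rw [f.reg i hi, h₁]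
        refine Triple.assign (Term.small_of_ble rfl rfl) (fun b => ?_) ?_
        -- The incremented counter is at most the limit in register `y`, which is itself bounded by
        -- M.
        · have := b.reg y
          rw [f.reg y hy] at this
          simp only [Term.eval_add, Term.eval_reg, Term.eval_one, e₁]
          omega
        · exact ⟨by simp [e₁], hI _ _ _ q⟩
      · rintro s'' f ⟨q₁, q₂⟩
        refine ih (j + 1) s'' (by omega) q₁ (fun x hx hx' => ?_) (fun a ha => ?_) q₂
        · rw [f.reg x (by simp [Program.regs, hx, hx']), h₂ x hx hx']
        · rw [f.arr a (by simp [Program.arrs, ha]), h₃ a ha]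
  refine Triple.mono (k := 1 + (N * (k + 2) + 1)) (Q := I N) ?_ (by omega) (fun _ h => h)
  refine Triple.seq (Q' := fun s' => s' = s.setReg i 0) (Triple.assign (Term.small_of_ble rfl rfl) ?_ rfl) ?_
  · intro _; simp
  · rintro s' - rfl
    refine main N 0 _ (by omega) (by simp) ?_ (fun _ _ => rfl) (hI _ _ _ h₀)
    intro x hx _
    simp [hx]

/-- Write the values of `e` to the cells of the array `a` whose indices are the values of `ix`,
for all `i` below the value of the register `y`. -/
def mapLoop (i y a : ℕ) (ix e : Term) : Program := forLoop i y (.store a ix e)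

/-- The body may assume that cells not yet written keep their old contents, which allows updates of
an array in place. -/
theorem Triple.mapLoop {M i y a N : ℕ} {ix e : Term} {s : Store} (base : ℕ) (f : ℕ → ℕ)
    (hyi : y ≠ i) (hN : s.reg y = N) (hix : ix.Small) (he : e.Small)
    (h : ∀ j < N, ∀ s', s'.reg i = j → (∀ x, x ≠ i → s'.reg x = s.reg x) →
      (∀ a', a' ≠ a → s'.arr a' = s.arr a') →
      (∀ l, (∀ j' < j, l ≠ base + j') → s'.arr a l = s.arr a l) →
      ix.eval s' = base + j ∧ e.eval s' = f j ∧ (s.Bdd M → f j ≤ M)) :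
    Triple M (mapLoop i y a ix e) s (N * 3 + 2) (fun s' =>
      (∀ j < N, s'.arr a (base + j) = f j) ∧
      ∀ l, (∀ j < N, l ≠ base + j) → s'.arr a l = s.arr a l) := by
  refine Triple.of_bdd fun hb => ?_
  refine (Triple.forLoop (k := 1) (fun m s' => (∀ j < m, s'.arr a (base + j) = f j) ∧
      ∀ l, (∀ j < m, l ≠ base + j) → s'.arr a l = s.arr a l) (by simp [Program.regs])
      (by simp [Program.regs]) hyi hN (fun _ _ _ h => h) ⟨by simp, by simp⟩ ?_)
  intro j hj s' h₁ h₂ h₃ ⟨h₄, h₅⟩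
  obtain ⟨e₁, e₂, e₃⟩ := h j hj s' h₁ (fun x hx => h₂ x hx (by simp [Program.regs]))
    (fun a' ha' => h₃ a' (by simpa [Program.arrs] using ha')) h₅
  refine Triple.store hix he (fun _ => e₂ ▸ e₃ hb) ⟨fun j' hj' => ?_, fun l hl => ?_⟩
  · rw [Store.setCell_arr, e₁, e₂]
    by_cases hjj : j' = j
    · simp [hjj]
    · simp [hjj, h₄ j' (by omega)]
  · rw [Store.setCell_arr, e₁, if_neg (fun h => hl j (by omega) h.2)]
    exact h₅ l fun j' hj' => hl j' (by omega)

/-- Add up the values of `e` in the register `x`, for all `i` below the value of the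
register `y`. -/
def sumLoop (i y x : ℕ) (e : Term) : Program :=
  .seq (.assign x 0) (forLoop i y (.assign x (.reg x + e)))

theorem Triple.sumLoop {M i y x N : ℕ} {e : Term} {s : Store} (f : ℕ → ℕ)
    (hyi : y ≠ i) (hyx : y ≠ x) (hxi : x ≠ i) (hN : s.reg y = N) (he : (Term.reg x + e).Small)
    (hM : s.Bdd M → ∑ j ∈ Finset.range N, f j ≤ M)
    (h : ∀ j < N, ∀ s', s'.reg i = j → (∀ z, z ≠ i → z ≠ x → s'.reg z = s.reg z) →
      s'.arr = s.arr → e.eval s' = f j) :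
    Triple M (sumLoop i y x e) s (N * 3 + 3)
      (fun s' => s'.reg x = ∑ j ∈ Finset.range N, f j) := by
  refine Triple.of_bdd fun hb => ?_
  refine Triple.mono (k := 1 + (N * 3 + 2)) (Q := fun s' => s'.reg x = ∑ j ∈ Finset.range N, f j)
    ?_ (by omega) (fun _ h => h)
  refine Triple.seq (Q' := fun s' => s' = s.setReg x 0) (Triple.assign (Term.small_of_ble rfl rfl) (by simp) rfl) ?_
  rintro s' - rfl
  refine (Triple.forLoop (k := 1) (fun m s' => s'.reg x = ∑ j ∈ Finset.range m, f j)
    (by simpa [Program.regs] using hxi.symm)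
    (by simpa [Program.regs] using hyx) hyi (by simp [hyx, hN]) ?_ (by simp) ?_)
  · intro j s v h
    simp [hxi, h]
  · intro j hj s' h₁ h₂ h₃ h₄
    have e₁ : e.eval s' = f j := h j hj s' h₁
      (fun z hz hz' => by rw [h₂ z hz (by simpa [Program.regs] using hz')]; simp [hz'])
      (funext fun a => h₃ a (by simp [Program.arrs]))
    have e₂ : (Term.reg x + e).eval s' = ∑ j ∈ Finset.range (j + 1), f j := by
      rw [Finset.sum_range_succ, Term.eval_add, Term.eval_reg, h₄, e₁]
    refine Triple.assign he (fun _ => ?_) (by rw [e₂]; simp)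
    rw [e₂]
    -- Partial sums are dominated by the full sum, so one bound suffices.
    exact (Finset.sum_le_sum_of_subset (by simpa using hj)).trans (hM hb)

end RAM

/-! ### Reachability inside a vertex set -/

section Reach

variable {V : Type*} {G : Digraph V}

/-- There is a walk in `G` from `u` to `v` all of whose vertices, with the possible exception
of `u`, are in `W`. -/
def ReachIn (G : Digraph V) (W : Finset V) : V → V → Prop :=
  Relation.ReflTransGen fun a b => G.Adj a b ∧ b ∈ W

theorem ReachIn.refl (W : Finset V) (u : V) : ReachIn G W u u := Relation.ReflTransGen.refl

theorem ReachIn.mono {W W' : Finset V} (h : W ⊆ W') {u v : V} (hr : ReachIn G W u v) :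
    ReachIn G W' u v :=
  Relation.ReflTransGen.mono (r := fun a b => G.Adj a b ∧ b ∈ W)
    (fun _ _ hab => ⟨hab.1, h hab.2⟩) _ _ hr

theorem ReachIn.step {W : Finset V} {u v w : V} (hr : ReachIn G W u v) (ha : G.Adj v w)
    (hw : w ∈ W) : ReachIn G W u w := Relation.ReflTransGen.tail hr ⟨ha, hw⟩

theorem ReachIn.trans {W : Finset V} {u v w : V} (h₁ : ReachIn G W u v) (h₂ : ReachIn G W v w) :
    ReachIn G W u w := Relation.ReflTransGen.trans h₁ h₂

theorem ReachIn.head {W : Finset V} {u v w : V} (ha : G.Adj u v) (hv : v ∈ W)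
    (h₂ : ReachIn G W v w) : ReachIn G W u w := Relation.ReflTransGen.head ⟨ha, hv⟩ h₂

theorem ReachIn.mem {W : Finset V} {u v : V} (h : ReachIn G W u v) : v = u ∨ v ∈ W := by
  cases h with
  | refl => exact .inl rfl
  | tail _ h => exact .inr h.2

theorem ReachIn.restrict {W B : Finset V} {u v : V} (hB : ∀ a ∈ W, ReachIn G W u a → a ∈ B)
    (h : ReachIn G W u v) : ReachIn G B u v := by
  induction h with
  | refl => exact .refl _ _
  | @tail b c hb hbc ih => exact ih.step hbc.1 (hB _ hbc.2 (Relation.ReflTransGen.tail hb hbc))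

variable [DecidableEq V]

/-- Whenever the walk returns to its start, it can be restarted there. -/
theorem ReachIn.erase {W : Finset V} {u v : V} (h : ReachIn G W u v) :
    ReachIn G (W.erase u) u v := by
  induction h with
  | refl => exact .refl _ _
  | @tail b c _ hbc ih =>
    by_cases hc : c = u
    · rw [hc]; exact .refl _ _
    · exact ih.step hbc.1 (Finset.mem_erase.2 ⟨hc, hbc.2⟩)

/-- If the walk met `B`, then its end would be reached from `w` as well. -/
theorem ReachIn.sdiff {W B : Finset V} {u v w : V} (hB : ∀ a ∈ B, ReachIn G W w a)
    (h : ReachIn G W u v) (hv : ¬ ReachIn G W w v) : ReachIn G (W \ B) u v := by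
  induction h with
  | refl => exact .refl _ _
  | @tail b c _ hbc ih =>
    refine (ih fun hb => hv (hb.step hbc.1 hbc.2)).step hbc.1 ?_
    exact Finset.mem_sdiff.2 ⟨hbc.2, fun hc => hv (hB _ hc)⟩

/-- The last vertex outside `R` of a walk from `r` in `R ∪ S`. -/
theorem ReachIn.exists_last {R S : Finset V} {r v : V} (h : ReachIn G (R ∪ S) r v) :
    ∃ a ∈ insert r S, ReachIn G R a v := by
  induction h with
  | refl => exact ⟨r, by simp, .refl _ _⟩
  | @tail b c _ hbc ih =>
    obtain ⟨a, ha, hab⟩ := ih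
    rcases Finset.mem_union.1 hbc.2 with hc | hc
    · exact ⟨a, ha, hab.step hbc.1 hc⟩
    · exact ⟨c, by simp [hc], .refl _ _⟩

/-- The first new vertex of a walk from `r` in `R ∪ S` that leaves `R ∪ A`. -/
theorem ReachIn.exists_first {R S A : Finset V} {r v : V} (h : ReachIn G (R ∪ S) r v)
    (hv : v ∈ S \ A) : ∃ c ∈ S \ A, ReachIn G (R ∪ insert c A) r c := by
  have key : ReachIn G (R ∪ A) r v ∨ ∃ c ∈ S \ A, ReachIn G (R ∪ insert c A) r c := by
    clear hv
    induction h with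
    | refl => exact .inl (.refl _ _)
    | @tail b c _ hbc ih =>
      rcases ih with ih | ih
      · by_cases hc : c ∈ R ∪ A
        · exact .inl (ih.step hbc.1 hc)
        · simp only [Finset.mem_union, not_or] at hc
          refine .inr ⟨c, ?_, (ih.mono ?_).step hbc.1 (by simp)⟩
          · have := hbc.2; simp only [Finset.mem_union] at this; simp [hc.2]; tauto
          · exact Finset.union_subset_union_right (Finset.subset_insert _ _)
      · exact .inr ih
  rcases key with h | h
  · exact ⟨v, hv, h.mono (Finset.union_subset_union_right (Finset.subset_insert _ _))⟩
  · exact h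

/-- If the weight of a vertex is at most `b` times the number of Steiner vertices needed for
reaching it from `r`, then the total weight of a connected set of `q` Steiner vertices is at most
`b * q * (q + 1) / 2`. -/
theorem two_mul_sum_weight_le {R S : Finset V} {r : V} {w : V → ℕ} {b : ℕ}
    (hw : ∀ v B, ReachIn G (R ∪ B) r v → w v ≤ B.card * b)
    (hS : ∀ v ∈ S, ReachIn G (R ∪ S) r v) :
    2 * ∑ v ∈ S, w v ≤ S.card * (S.card + 1) * b := by
  -- Grow `A` by the first new vertex on a walk that leaves it. The vertex that makes the size i + 1
  -- is reached with i + 1 Steiner vertices, itself included, so it weighs at most (i + 1)b, and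
  -- these bounds add up to a triangular number.
  have key : ∀ i ≤ S.card, ∃ A ⊆ S, A.card = i ∧ 2 * ∑ v ∈ A, w v ≤ i * (i + 1) * b := by
    intro i
    induction i with
    | zero => exact fun _ => ⟨∅, by simp, by simp, by simp⟩
    | succ i ih =>
      intro hi
      obtain ⟨A, hA, hc, hs⟩ := ih (by omega)
      obtain ⟨v, hv⟩ : (S \ A).Nonempty := by
        rw [← Finset.card_pos, Finset.card_sdiff_of_subset hA]; omega
      obtain ⟨c, hcS, hr⟩ := (hS v (Finset.mem_sdiff.1 hv).1).exists_first hv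
      rw [Finset.mem_sdiff] at hcS
      refine ⟨insert c A, Finset.insert_subset hcS.1 hA, ?_, ?_⟩
      · rw [Finset.card_insert_of_notMem hcS.2, hc]
      · have := hw c _ hr
        rw [Finset.card_insert_of_notMem hcS.2, hc] at this
        rw [Finset.sum_insert hcS.2]
        nlinarith
  obtain ⟨A, hA, hc, hs⟩ := key S.card le_rfl
  rwa [Finset.eq_of_subset_of_card_le hA hc.ge] at hs

/-- The terminals in `U` that are reached from each Steiner vertex are few, so `U` is small. -/
theorem two_mul_card_uncovered_le {R S U : Finset V} {r : V} {a b : ℕ} (hUR : U ⊆ R)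
    (hU : ∀ v B, ReachIn G (R ∪ B) r v → ∀ C ⊆ U, (∀ t ∈ C, ReachIn G R v t) →
      C.card * a ≤ B.card * b)
    (hR : ∀ v ∈ R ∪ S, ReachIn G (R ∪ S) r v) :
    2 * (U.card * a) ≤ S.card * (S.card + 1) * b := by
  classical
  let w : V → ℕ := fun v => (U.filter fun t => ReachIn G R v t).card * a
  have hw : ∀ v B, ReachIn G (R ∪ B) r v → w v ≤ B.card * b := fun v B hv =>
    hU v B hv _ (Finset.filter_subset _ _) fun t ht => (Finset.mem_filter.1 ht).2
  refine le_trans ?_ (two_mul_sum_weight_le hw fun v hv => hR v (by simp [hv]))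
  -- Each uncovered terminal is charged to the last vertex of `S` on a walk from the root, or to the
  -- root.
  have h₁ : U ⊆ (insert r S).biUnion fun v => U.filter fun t => ReachIn G R v t := by
    intro t ht
    obtain ⟨v, hv, hvt⟩ := (hR t (by simp [hUR ht])).exists_last
    exact Finset.mem_biUnion.2 ⟨v, hv, Finset.mem_filter.2 ⟨ht, hvt⟩⟩
  have h₂ : U.card * a ≤ ∑ v ∈ insert r S, w v := by
    rw [← Finset.sum_mul]
    exact Nat.mul_le_mul_right _ ((Finset.card_le_card h₁).trans Finset.card_biUnion_le)
  -- The root is reached without any Steiner vertex, so it carries no weight.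
  have h₃ : w r = 0 := by simpa using hw r ∅ (.refl _ _)
  have h₄ : ∑ v ∈ insert r S, w v ≤ w r + ∑ v ∈ S, w v := by
    by_cases hr : r ∈ S
    · rw [Finset.insert_eq_of_mem hr]; omega
    · rw [Finset.sum_insert hr]
  omega

end Reach

/-! ### Subsets of a set of terminals as bit masks -/

section Mask

variable {V : Type*} [LinearOrder V] (T : Finset V)

/-- The weight of the vertex `u` in bit masks for subsets of `T`. -/
def bitOf (u : V) : ℕ := if u ∈ T then 2 ^ (T.filter (· < u)).card else 0

/-- The bit mask of a subset of `T`. -/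
def maskOf (X : Finset V) : ℕ := ∑ u ∈ X, bitOf T u

/-- The subset of `T` with the given bit mask. -/
def maskSet (X : ℕ) : Finset V := T.filter fun u => X / bitOf T u % 2 = 1

theorem rank_injOn : Set.InjOn (fun u => (T.filter (· < u)).card) T := by
  have key : ∀ u ∈ T, ∀ v ∈ T, u < v → (T.filter (· < u)).card < (T.filter (· < v)).card := by
    intro u hu v hv h
    refine Finset.card_lt_card ⟨fun x hx => ?_, fun h' => ?_⟩
    · simp only [Finset.mem_filter] at hx ⊢; exact ⟨hx.1, hx.2.trans h⟩
    · have := h' (Finset.mem_filter.2 ⟨hu, h⟩); simp at this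
  intro u hu v hv h
  rcases lt_trichotomy u v with h' | h' | h'
  · exact absurd h (key u hu v hv h').ne
  · exact h'
  · exact absurd h (key v hv u hu h').ne'

variable {T}

/-- Ranks in `T` are distinct, so a mask is a sum of distinct powers of two and can be decoded from
its binary digits. -/
theorem maskOf_eq_sum_two_pow {X : Finset V} (hX : X ⊆ T) :
    maskOf T X = ∑ i ∈ X.image (fun u => (T.filter (· < u)).card), 2 ^ i := by
  rw [Finset.sum_image fun a ha b hb h => rank_injOn T (hX ha) (hX hb) h]
  exact Finset.sum_congr rfl fun u hu => if_pos (hX hu)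

theorem maskSet_maskOf {X : Finset V} (hX : X ⊆ T) : maskSet T (maskOf T X) = X := by
  ext u
  simp only [maskSet, Finset.mem_filter]
  constructor
  · rintro ⟨hu, h⟩
    rw [bitOf, if_pos hu] at h
    have h' : (maskOf T X).testBit (T.filter (· < u)).card := by
      rw [Nat.testBit_eq_decide_div_mod_eq]; simpa using h
    rw [← Nat.mem_bitIndices, ← List.mem_toFinset, maskOf_eq_sum_two_pow hX,
      Finset.toFinset_bitIndices_sum_two_pow, Finset.mem_image] at h'
    obtain ⟨a, ha, hau⟩ := h'
    rwa [rank_injOn T (hX ha) hu hau] at ha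
  · intro hu
    refine ⟨hX hu, ?_⟩
    have h' : (maskOf T X).testBit (T.filter (· < u)).card := by
      rw [← Nat.mem_bitIndices, ← List.mem_toFinset, maskOf_eq_sum_two_pow hX,
        Finset.toFinset_bitIndices_sum_two_pow]
      exact Finset.mem_image_of_mem _ hu
    rw [bitOf, if_pos (hX hu)]
    rw [Nat.testBit_eq_decide_div_mod_eq] at h'; simpa using h'

theorem maskOf_lt {X : Finset V} (hX : X ⊆ T) : maskOf T X < 2 ^ T.card := by
  rw [maskOf_eq_sum_two_pow hX]
  refine Nat.geomSum_lt le_rfl fun k hk => ?_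
  obtain ⟨u, hu, rfl⟩ := Finset.mem_image.1 hk
  exact Finset.card_lt_card ⟨Finset.filter_subset _ _, fun h => by
    have := h (hX hu); simp at this⟩

theorem maskSet_subset (X : ℕ) : maskSet T X ⊆ T := Finset.filter_subset _ _

/-- The mask for the union of two sets that are given by masks. -/
def maskUnion (T : Finset V) (Y Z : ℕ) : ℕ := maskOf T (maskSet T Y ∪ maskSet T Z)

theorem maskUnion_lt (Y Z : ℕ) : maskUnion T Y Z < 2 ^ T.card :=
  maskOf_lt (Finset.union_subset (maskSet_subset _) (maskSet_subset _))

end Mask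

/-! ### The table of partial solutions -/

section Table

variable {V : Type*} [LinearOrder V] [Fintype V] {G : Digraph V} {R T : Finset V}

/-- The entry for the mask `X` and the vertex `v` is a set of Steiner vertices by which all
vertices in the set with mask `X` are reached from `v`, or the trivial set. -/
def TableSound (G : Digraph V) (R T : Finset V) (F : ℕ → V → Finset V) : Prop :=
  ∀ X < 2 ^ T.card, ∀ v, F X v = Finset.univ ∨ ∀ t ∈ maskSet T X, ReachIn G (R ∪ F X v) v t

/-- The entries are at least as good as all solutions on at most `j` vertices. -/
def TableComplete (G : Digraph V) (R T : Finset V) (j : ℕ) (F : ℕ → V → Finset V) : Prop :=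
  ∀ v A X, A.card ≤ j → X ⊆ T → (∀ t ∈ X, ReachIn G A v t) →
    (F (maskOf T X) v).card ≤ (A \ R).card

/-- The entries before any combination of partial solutions. -/
def tableInit (T : Finset V) (X : ℕ) (v : V) : Finset V :=
  if X = 0 ∨ X = bitOf T v then ∅ else Finset.univ

/-- The empty mask demands nothing, and the mask of {v} is served by standing at `v`. For `v`
outside `T` the two masks coincide. -/
theorem tableInit_sound : TableSound G R T (tableInit T) := by
  intro X _ v
  by_cases h : X = 0 ∨ X = bitOf T v
  · right
    intro t ht
    suffices t = v by rw [this]; exact .refl _ _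
    have hX : X = maskOf T (if X = 0 then ∅ else {v}) ∧ (if X = 0 then ∅ else {v}) ⊆ T := by
      split_ifs with h0
      · simp [h0, maskOf]
      · have h1 : X = bitOf T v := by tauto
        refine ⟨by simp [maskOf, h1], ?_⟩
        by_contra hv
        rw [Finset.singleton_subset_iff] at hv
        exact h0 (by rw [h1, bitOf, if_neg hv])
    rw [hX.1, maskSet_maskOf hX.2] at ht
    clear hX
    split_ifs at ht
    · simp at ht
    · simpa using ht
  · exact .inl (if_neg h)

theorem tableInit_complete : TableComplete G R T 0 (tableInit T) := by
  intro v A X hA _ hX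
  obtain rfl : A = ∅ := by simpa using hA
  have h : ∀ t ∈ X, t = v := fun t ht => by simpa using (hX t ht).mem
  have : maskOf T X = 0 ∨ maskOf T X = bitOf T v := by
    rcases Finset.subset_singleton_iff.1 (fun t ht => Finset.mem_singleton.2 (h t ht) : X ⊆ {v})
      with rfl | rfl
    · simp [maskOf]
    · simp [maskOf]
  rw [tableInit, if_pos this]
  simp

/-- The solution for `v` combined from one that starts with the arc to `w` and another one. -/
def combine {V : Type*} [DecidableEq V] (R : Finset V) (F : ℕ → V → Finset V) (v w : V) (Y Z : ℕ) : Finset V :=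
  F Y w ∪ F Z v ∪ ({w} \ R)

theorem card_combine_le {V : Type*} [DecidableEq V] {R : Finset V} (F : ℕ → V → Finset V) (v w : V) (Y Z : ℕ) :
    (combine R F v w Y Z).card ≤ (F Y w).card + (F Z v).card + ({w} \ R).card :=
  (Finset.card_union_le _ _).trans (Nat.add_le_add_right (Finset.card_union_le _ _) _)

/-- The trivial set absorbs unions and so plays the role of an infinite entry. Otherwise the targets
in `Y` are reached through the arc to `w`, those in `Z` directly from `v`. -/
theorem combine_sound {F : ℕ → V → Finset V} (hF : TableSound G R T F) {v w : V}
    (hvw : G.Adj v w) {Y Z : ℕ} (hY : Y < 2 ^ T.card) (hZ : Z < 2 ^ T.card) :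
    combine R F v w Y Z = Finset.univ ∨
      ∀ t ∈ maskSet T (maskUnion T Y Z), ReachIn G (R ∪ combine R F v w Y Z) v t := by
  rcases hF Y hY w with h₁ | h₁
  · left; simp [combine, h₁, Finset.eq_univ_iff_forall]
  rcases hF Z hZ v with h₂ | h₂
  · left; simp [combine, h₂, Finset.eq_univ_iff_forall]
  right
  intro t ht
  rw [maskUnion, maskSet_maskOf (Finset.union_subset (maskSet_subset _) (maskSet_subset _)),
    Finset.mem_union] at ht
  rcases ht with ht | ht
  · refine .head hvw ?_ ((h₁ t ht).mono ?_)
    · simp only [combine, Finset.mem_union, Finset.mem_sdiff, Finset.mem_singleton]; tauto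
    · intro a; simp only [combine, Finset.mem_union]; tauto
  · refine (h₂ t ht).mono ?_
    intro a; simp only [combine, Finset.mem_union]; tauto

/-- One round of combinations extends the range of solutions that are beaten by one vertex. -/
theorem TableComplete.succ {j : ℕ} {F F' : ℕ → V → Finset V} (hF : TableComplete G R T j F)
    (hle : ∀ X < 2 ^ T.card, ∀ v, (F' X v).card ≤ (F X v).card)
    (hc : ∀ v w, G.Adj v w → ∀ Y < 2 ^ T.card, ∀ Z < 2 ^ T.card,
      (F' (maskUnion T Y Z) v).card ≤ (F Y w).card + (F Z v).card + ({w} \ R).card) :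
    TableComplete G R T (j + 1) F' := by
  classical
  intro v A X hA hXT hX
  -- If the start is the only target, there is no first arc to split off, and the empty vertex set
  -- already serves.
  by_cases hv : ∀ t ∈ X, t = v
  · refine ((hle _ (maskOf_lt hXT) v).trans
      (hF v ∅ X (by simp) hXT fun t ht => ?_)).trans (by simp)
    rw [hv t ht]; exact .refl _ _
  push Not at hv
  obtain ⟨t, ht, htv⟩ := hv
  obtain h | ⟨w, ⟨hvw, hwA⟩, hwt⟩ := (hX t ht).cases_head
  · exact absurd h.symm htv
  replace hwt : ReachIn G A w t := hwt
  -- Split `A` by reachability from `w`. Inside `B` the start `w` can be dropped, and the targets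
  -- not reached from `w` are reached from `v` avoiding `B`. Both parts miss `w`, so they have at
  -- most `j` vertices.
  set B := A.filter fun a => ReachIn G A w a with hB
  set Y := X.filter fun a => ReachIn G A w a with hY
  have hwB : w ∈ B := Finset.mem_filter.2 ⟨hwA, .refl _ _⟩
  have hBA : B ⊆ A := Finset.filter_subset _ _
  have hYX : Y ⊆ X := Finset.filter_subset _ _
  have h₁ : ∀ t ∈ Y, ReachIn G (B.erase w) w t := fun t ht =>
    ((Finset.mem_filter.1 ht).2.restrict fun a ha h => Finset.mem_filter.2 ⟨ha, h⟩).erase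
  have h₂ : ∀ t ∈ X \ Y, ReachIn G (A \ B) v t := by
    intro t ht
    rw [Finset.mem_sdiff] at ht
    exact (hX t ht.1).sdiff (fun a ha => (Finset.mem_filter.1 ha).2)
      fun h => ht.2 (Finset.mem_filter.2 ⟨ht.1, h⟩)
  have c₁ : (B.erase w).card ≤ j := by
    rw [Finset.card_erase_of_mem hwB]; have := Finset.card_le_card hBA; omega
  have c₂ : (A \ B).card ≤ j := by
    have := Finset.card_lt_card (Finset.sdiff_ssubset hBA ⟨w, hwB⟩); omega
  have s₂ : X \ Y ⊆ T := Finset.sdiff_subset.trans hXT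
  have h₃ := hF w (B.erase w) Y c₁ (hYX.trans hXT) h₁
  have h₄ := hF v (A \ B) (X \ Y) c₂ s₂ h₂
  have h₅ := hc v w hvw _ (maskOf_lt (hYX.trans hXT)) _ (maskOf_lt s₂)
  rw [maskUnion, maskSet_maskOf (hYX.trans hXT), maskSet_maskOf s₂, Finset.union_sdiff_of_subset hYX]
    at h₅
  refine h₅.trans ((Nat.add_le_add_right (Nat.add_le_add h₃ h₄) _).trans ?_)
  -- The two parts and {w} are pairwise disjoint subsets of `A`, so their Steiner vertices are
  -- counted once.
  rw [← Finset.card_union_of_disjoint, ← Finset.card_union_of_disjoint]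
  · refine Finset.card_le_card fun a ha => ?_
    simp only [Finset.mem_union, Finset.mem_sdiff, Finset.mem_erase, Finset.mem_singleton] at ha ⊢
    rcases ha with (⟨⟨_, h⟩, h'⟩ | ⟨⟨h, _⟩, h'⟩) | ⟨rfl, h'⟩
    exacts [⟨hBA h, h'⟩, ⟨h, h'⟩, ⟨hwA, h'⟩]
  · rw [Finset.disjoint_left]
    intro a ha ha'
    simp only [Finset.mem_union, Finset.mem_sdiff, Finset.mem_erase, Finset.mem_singleton] at ha ha'
    obtain ⟨rfl, -⟩ := ha'
    tauto
  · rw [Finset.disjoint_left]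
    intro a ha ha'
    simp only [Finset.mem_sdiff, Finset.mem_erase] at ha ha'
    tauto

/-- Among the sets of Steiner vertices by which `r` reaches `T`, when `R` is free, the set `P` is
smallest. If there are no such sets, then `P` is the trivial set. -/
structure IsSteinerMin (G : Digraph V) (r : V) (R T P : Finset V) : Prop where
  valid : P = Finset.univ ∨ ∀ t ∈ T, ReachIn G (R ∪ P) r t
  card_le : ∀ B : Finset V, (∀ t ∈ T, ReachIn G (R ∪ B) r t) → P.card ≤ B.card

/-- As soon as some vertex set works, the trivial set works too, since it contains all vertices. -/
theorem IsSteinerMin.reach {r : V} {P B : Finset V} (h : IsSteinerMin G r R T P)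
    (hB : ∀ t ∈ T, ReachIn G B r t) : ∀ t ∈ T, ReachIn G (R ∪ P) r t := by
  rcases h.valid with h | h
  · exact fun t ht => (hB t ht).mono fun a _ => by simp [h]
  · exact h

/-- The entry for the root and the full mask is optimal once the table is complete. -/
theorem table_optimal {F : ℕ → V → Finset V} (hs : TableSound G R T F)
    (hc : TableComplete G R T (Fintype.card V) F) (r : V) :
    IsSteinerMin G r R T (F (maskOf T T) r) where
  valid := by
    have := hs _ (maskOf_lt le_rfl) r
    rwa [maskSet_maskOf le_rfl] at this
  card_le B hB := by
    refine (hc r (R ∪ B) T (Finset.card_le_univ _) le_rfl hB).trans (Finset.card_le_card ?_)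
    intro a; simp only [Finset.mem_sdiff, Finset.mem_union]; tauto

end Table

/-! ### The dynamic program on the machine -/

namespace RAM

variable {n : ℕ}

/-- The function `f` is the characteristic function of `S`. -/
def IsIndicator (f : ℕ → ℕ) (S : Finset (Fin n)) : Prop := ∀ u : Fin n, f u = if u ∈ S then 1 else 0

theorem IsIndicator.sum {f : ℕ → ℕ} {S : Finset (Fin n)} (h : IsIndicator f S) :
    ∑ j ∈ Finset.range n, f j = S.card := by
  rw [Finset.sum_range, Finset.sum_congr rfl fun u _ => h u]
  simp

theorem card_le_of_fin (S : Finset (Fin n)) : S.card ≤ n := by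
  simpa using S.card_le_univ

/-- The store describes the graph `G` and the root `r`. -/
structure HasGraph (G : Digraph (Fin n)) (r : Fin n) (s : Store) : Prop where
  size : s.reg 0 = n
  root : s.reg 1 = r
  adj : ∀ u v : Fin n, s.arr 0 (u * n + v) ≠ 0 ↔ G.Adj u v

theorem HasGraph.of_eq {G : Digraph (Fin n)} {r : Fin n} {s s' : Store} (h : HasGraph G r s)
    (h₀ : s'.reg 0 = s.reg 0) (h₁ : s'.reg 1 = s.reg 1) (h₂ : s'.arr 0 = s.arr 0) :
    HasGraph G r s' :=
  ⟨h₀.trans h.size, h₁.trans h.root, by rw [h₂]; exact h.adj⟩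

theorem index_inj {X X' : ℕ} {v v' u u' : Fin n}
    (h : (X * n + v) * n + u = (X' * n + v') * n + u') : X = X' ∧ v = v' ∧ u = u' := by
  have hn : 0 < n := u.pos
  have key : ∀ {a b : ℕ} {c d : Fin n}, a * n + c = b * n + d → a = b ∧ c = d := by
    intro a b c d h
    have h₁ := congrArg (· / n) h
    have h₂ := congrArg (· % n) h
    simp only [mul_comm a n, mul_comm b n, Nat.mul_add_div hn, Nat.div_eq_of_lt c.2,
      Nat.div_eq_of_lt d.2, Nat.mul_add_mod, Nat.mod_eq_of_lt c.2, Nat.mod_eq_of_lt d.2] at h₁ h₂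
    exact ⟨by omega, Fin.ext h₂⟩
  obtain ⟨h₁, h₂⟩ := key h
  obtain ⟨h₃, h₄⟩ := key h₁
  exact ⟨h₃, h₄, h₂⟩

/-- Array `5` holds the table `F` for the terminal set `T`. -/
def HasTable (T : Finset (Fin n)) (F : ℕ → Fin n → Finset (Fin n)) (s : Store) : Prop :=
  ∀ X < 2 ^ T.card, ∀ v u : Fin n,
    s.arr 5 ((X * n + v) * n + u) = if u ∈ F X v then 1 else 0

/-- Array `4` holds the weights of the vertices in masks for subsets of `T`. -/
def HasBits (T : Finset (Fin n)) (s : Store) : Prop := ∀ u : Fin n, s.arr 4 u = bitOf T u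

/-- Compute the weights of the vertices in masks for subsets of the set in array `12`. -/
def bitLoop : Program :=
  forLoop 25 0 (.seq (.store 4 (.reg 25) (.cell 12 (.reg 25) * .reg 12))
    (.assign 12 (.reg 12 + .cell 12 (.reg 25) * .reg 12)))

/-- Register 12 holds 2 to the number of elements of `T` met so far. This is the weight of the next
one and, at the end, the number of masks. -/
theorem bitLoop_spec {M : ℕ} {s : Store} {T : Finset (Fin n)} (h₀ : s.reg 0 = n)
    (h₁ : s.reg 12 = 1) (hT : IsIndicator (s.arr 12) T) (hM : 2 ^ n ≤ M) :
    Triple M bitLoop s (n * 4 + 2) (fun s' => s'.reg 12 = 2 ^ T.card ∧ HasBits T s') := by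
  refine (Triple.forLoop (k := 2) (fun j s' => s'.reg 12 = 2 ^ (T.filter fun t => t.1 < j).card ∧
    ∀ u : Fin n, u.1 < j → s'.arr 4 u = bitOf T u) (by decide) (by decide) (by decide) h₀
    ?_ (by simp [h₁]) ?_).mono le_rfl ?_
  · intro j s v h
    simpa using h
  · rintro j hj s' e₁ e₂ e₃ ⟨e₄, e₅⟩
    have e₆ : s'.arr 12 j = if (⟨j, hj⟩ : Fin n) ∈ T then 1 else 0 := by
      rw [e₃ 12 (by decide)]; exact hT ⟨j, hj⟩
    have hle : ∀ i, 2 ^ (T.filter fun t => t.1 < i).card ≤ M := fun i =>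
      (Nat.pow_le_pow_right (by omega) (card_le_of_fin _)).trans hM
    have hs : 2 ^ (T.filter fun t => t.1 < j + 1).card =
        s'.reg 12 + s'.arr 12 j * s'.reg 12 := by
      have : (T.filter fun t => t.1 < j + 1) =
          (T.filter fun t => t.1 < j) ∪ (T ∩ {⟨j, hj⟩}) := by
        ext t
        simp only [Finset.mem_filter, Finset.mem_union, Finset.mem_inter, Finset.mem_singleton,
          Fin.ext_iff, Nat.lt_succ_iff_lt_or_eq]
        tauto
      rw [this, Finset.card_union_of_disjoint, pow_add, e₄, e₆]
      · split_ifs with h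
        · rw [Finset.inter_singleton_of_mem h]; simp; ring
        · rw [Finset.inter_singleton_of_notMem h]; simp
      · rw [Finset.disjoint_left]
        intro a
        simp only [Finset.mem_filter, Finset.mem_inter, Finset.mem_singleton, Fin.ext_iff]
        omega
    refine Triple.seq (k₁ := 1) (k₂ := 1) (Q' := fun s'' => s'' = s'.setCell 4 j (bitOf T ⟨j, hj⟩))
      (Triple.store (by decide) (by decide) ?_ ?_) ?_
    · intro b
      simp only [Term.eval_mul, Term.eval_cell, Term.eval_reg, e₁, e₆]
      split_ifs
      · simpa using b.reg 12
      · simp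
    · simp only [Term.eval_mul, Term.eval_cell, Term.eval_reg, e₁, e₆, bitOf, e₄]
      congr 1
      split_ifs
      · simp [Fin.lt_def]
      · simp
    · rintro s'' - rfl
      refine Triple.assign (by decide) ?_ ⟨?_, ?_⟩
      · intro _
        simp only [Term.eval_add, Term.eval_mul, Term.eval_cell, Term.eval_reg, Store.setCell_reg,
          Store.setCell_arr, e₁]
        rw [if_neg (by simp), ← hs]
        exact hle _
      · simpa [e₁] using hs.symm
      · intro u hu
        simp only [Store.setReg_arr, Store.setCell_arr, true_and]
        split_ifs with h
        · congr 1; exact Fin.ext h.symm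
        · exact e₅ u (by omega)
  · rintro s' ⟨h₂, h₃⟩
    refine ⟨by simpa using h₂, fun u => h₃ u u.2⟩

/-- Improve the table by a combination, for the vertices in the registers `16` and `17` and the
masks in the registers `18` and `19`. -/
def relax : Program :=
  .seq (sumLoop 25 0 20 (.cell 4 (.reg 25) * Term.less 0 (.reg 18 / .cell 4 (.reg 25) % 2 +
      .reg 19 / .cell 4 (.reg 25) % 2))) <|
  .seq (mapLoop 25 0 11 (.reg 25) (Term.less 0
      (.cell 5 ((.reg 18 * .reg 0 + .reg 17) * .reg 0 + .reg 25) +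
       .cell 5 ((.reg 19 * .reg 0 + .reg 16) * .reg 0 + .reg 25) +
       Term.same (.reg 25) (.reg 17) * (1 - .cell 3 (.reg 17))))) <|
  .seq (sumLoop 25 0 21 (.cell 11 (.reg 25))) <|
  .seq (sumLoop 25 0 22 (.cell 5 ((.reg 20 * .reg 0 + .reg 16) * .reg 0 + .reg 25))) <|
  .ite (Term.less (.reg 21) (.reg 22))
    (mapLoop 25 0 5 ((.reg 20 * .reg 0 + .reg 16) * .reg 0 + .reg 25) (.cell 11 (.reg 25))) .skip

/-- Replace an entry of the table if the new one is smaller. -/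
def improve (F : ℕ → Fin n → Finset (Fin n)) (X : ℕ) (v : Fin n) (S : Finset (Fin n)) :
    ℕ → Fin n → Finset (Fin n) :=
  fun X' v' => if X' = X ∧ v' = v ∧ S.card < (F X v).card then S else F X' v'

theorem improve_of_ne (F : ℕ → Fin n → Finset (Fin n)) {X X' : ℕ} {v v' : Fin n}
    (S : Finset (Fin n)) (h : ¬ (X' = X ∧ v' = v)) : improve F X v S X' v' = F X' v' :=
  if_neg fun h' => h ⟨h'.1, h'.2.1⟩

theorem improve_of_not_lt (F : ℕ → Fin n → Finset (Fin n)) {X : ℕ} {v : Fin n}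
    {S : Finset (Fin n)} (h : ¬ S.card < (F X v).card) : improve F X v S = F :=
  funext fun _ => funext fun _ => if_neg fun h' => h h'.2.2

theorem improve_self (F : ℕ → Fin n → Finset (Fin n)) {X : ℕ} {v : Fin n}
    {S : Finset (Fin n)} (h : S.card < (F X v).card) : improve F X v S X v = S :=
  if_pos ⟨rfl, rfl, h⟩

theorem card_improve_le (F : ℕ → Fin n → Finset (Fin n)) (X : ℕ) (v : Fin n)
    (S : Finset (Fin n)) (X' : ℕ) (v' : Fin n) :
    (improve F X v S X' v').card ≤ (F X' v').card := by
  rw [improve]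
  split_ifs with h
  · obtain ⟨rfl, rfl, h⟩ := h; exact h.le
  · exact le_rfl

theorem card_improve_self_le (F : ℕ → Fin n → Finset (Fin n)) (X : ℕ) (v : Fin n)
    (S : Finset (Fin n)) : (improve F X v S X v).card ≤ S.card := by
  by_cases h : S.card < (F X v).card
  · rw [improve_self F h]
  · rw [improve_of_not_lt F h]; omega

/-- The form that the machine evaluates. No membership test is needed: vertices outside `T` have
weight zero, which kills their summand. -/
theorem maskUnion_eq_sum (T : Finset (Fin n)) (Y Z : ℕ) :
    maskUnion T Y Z = ∑ u : Fin n, bitOf T u *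
      if 0 < Y / bitOf T u % 2 + Z / bitOf T u % 2 then 1 else 0 := by
  have h : ∀ u : Fin n, (u ∈ maskSet T Y ∪ maskSet T Z ↔
      u ∈ T ∧ 0 < Y / bitOf T u % 2 + Z / bitOf T u % 2) := by
    intro u
    simp only [maskSet, Finset.mem_union, Finset.mem_filter]
    constructor
    · rintro (⟨h, h'⟩ | ⟨h, h'⟩) <;> exact ⟨h, by omega⟩
    · rintro ⟨h, h'⟩
      by_cases h'' : Y / bitOf T u % 2 = 1
      · exact .inl ⟨h, h''⟩
      · exact .inr ⟨h, by omega⟩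
  rw [maskUnion, maskOf, ← Finset.sum_subset (Finset.subset_univ (maskSet T Y ∪ maskSet T Z))]
  · refine Finset.sum_congr rfl fun u hu => ?_
    rw [if_pos ((h u).1 hu).2, mul_one]
  · intro u _ hu
    by_cases huT : u ∈ T
    · rw [if_neg fun h' => hu ((h u).2 ⟨huT, h'⟩), mul_zero]
    · rw [bitOf, if_neg huT, zero_mul]

theorem relax_spec {M : ℕ} {s : Store} {R T : Finset (Fin n)} {F : ℕ → Fin n → Finset (Fin n)}
    {v w : Fin n} {Y Z : ℕ} (h₀ : s.reg 0 = n) (hv : s.reg 16 = v) (hw : s.reg 17 = w)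
    (hY : s.reg 18 = Y) (hZ : s.reg 19 = Z) (hYK : Y < 2 ^ T.card) (hZK : Z < 2 ^ T.card)
    (hR : IsIndicator (s.arr 3) R) (hT : HasBits T s) (hF : HasTable T F s) (hM : 2 ^ n ≤ M) :
    Triple M relax s (30 * n)
      (HasTable T (improve F (maskUnion T Y Z) v (combine R F v w Y Z))) := by
  have hn : 1 ≤ n := v.pos
  have hnM : n ≤ M := (Nat.lt_two_pow_self).le.trans hM
  have hXK := maskUnion_lt (T := T) Y Z
  set X := maskUnion T Y Z with hX
  set S := combine R F v w Y Z with hS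
  refine Triple.mono (k := (n * 3 + 3) + ((n * 3 + 2) + ((n * 3 + 3) + ((n * 3 + 3) +
    ((n * 3 + 2) + 1))))) ?_ (by omega) (fun _ h => h)
  refine Triple.seq (Triple.sumLoop (N := n) (fun j => s.arr 4 j *
    if 0 < Y / s.arr 4 j % 2 + Z / s.arr 4 j % 2 then 1 else 0) (by decide) (by decide) (by decide)
    h₀ (by decide) ?_ ?_) ?_
  · intro _
    rw [Finset.sum_range, Finset.sum_congr rfl fun u _ => by rw [hT u], ← maskUnion_eq_sum]
    exact (maskUnion_lt Y Z).le.trans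
      ((Nat.pow_le_pow_right (by omega) (card_le_of_fin _)).trans hM)
  · intro j _ s' e₁ e₂ e₃
    simp [e₁, e₂, e₃, hY, hZ]
  intro s₁ f₁ q₁
  rw [Finset.sum_range, Finset.sum_congr rfl fun u _ => by rw [hT u], ← maskUnion_eq_sum,
    ← hX] at q₁
  have r₁ : ∀ x, x ≠ 25 → x ≠ 20 → s₁.reg x = s.reg x := fun x h h' =>
    f₁.reg x (by simp [Program.regs, sumLoop, forLoop, h, h'])
  have a₁ : s₁.arr = s.arr := funext fun a => f₁.arr a (by simp [Program.arrs, sumLoop, forLoop])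
  clear f₁
  refine Triple.seq (Triple.mapLoop (N := n) 0 (fun j => if 0 <
      s.arr 5 ((Y * n + w) * n + j) + s.arr 5 ((Z * n + v) * n + j) +
        (if j = w then 1 else 0) * (1 - s.arr 3 w) then 1 else 0) (by decide)
      (by simp [r₁, h₀]) (by decide) (by decide) ?_) ?_
  · intro j _ s' e₁ e₂ e₃ _
    simp only [Term.eval_reg, Term.eval_less, Term.eval_same, Term.eval_add, Term.eval_cell,
      Term.eval_mul, Term.eval_sub, Term.eval_zero, Term.eval_one, e₁, zero_add, true_and]
    rw [e₂ 0, e₂ 17, e₂ 18, e₂ 19, e₂ 16, e₃ 5, e₃ 3, r₁, r₁, r₁, r₁, r₁, a₁, h₀, hv, hw, hY, hZ]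
    · refine ⟨rfl, fun b => ?_⟩
      have := b.two_le
      split_ifs <;> omega
    all_goals decide
  rintro s₂ f₂ ⟨q₂, -⟩
  have r₂ : ∀ x, x ≠ 25 → s₂.reg x = s₁.reg x := fun x h =>
    f₂.reg x (by simp [Program.regs, mapLoop, forLoop, h])
  have a₂ : ∀ a, a ≠ 11 → s₂.arr a = s.arr a := fun a h =>
    (f₂.arr a (by simp [Program.arrs, mapLoop, forLoop, h])).trans (by rw [a₁])
  clear f₂
  -- Membership in the union of three sets is computed as positivity of a sum of indicators.
  have hind : IsIndicator (s₂.arr 11) S := by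
    intro u
    have := q₂ u u.2
    rw [zero_add] at this
    rw [this, hF Y hYK, hF Z hZK, hR w]
    simp only [hS, combine, Finset.mem_union, Finset.mem_sdiff, Finset.mem_singleton, Fin.ext_iff]
    by_cases c₃ : u = w
    · subst c₃
      by_cases c₁ : u ∈ F Y u <;> by_cases c₂ : u ∈ F Z v <;> by_cases c₄ : u ∈ R <;>
        simp [c₁, c₂, c₄]
    · have c₃' : ¬ (u : ℕ) = w := fun h => c₃ (Fin.ext h)
      by_cases c₁ : u ∈ F Y w <;> by_cases c₂ : u ∈ F Z v <;> simp [c₁, c₂, c₃']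
  refine Triple.seq (Triple.sumLoop (N := n) (s₂.arr 11) (by decide) (by decide) (by decide)
    (by simp [r₂, r₁, h₀]) (by decide) ?_ ?_) ?_
  · intro _
    rw [hind.sum]
    exact (card_le_of_fin _).trans hnM
  · intro j _ s' e₁ e₂ e₃
    simp [e₁, e₃]
  intro s₃ f₃ q₃
  rw [hind.sum] at q₃
  have r₃ : ∀ x, x ≠ 25 → x ≠ 21 → s₃.reg x = s₁.reg x := fun x h h' =>
    (f₃.reg x (by simp [Program.regs, sumLoop, forLoop, h, h'])).trans (r₂ x h)
  have a₃ : s₃.arr = s₂.arr := funext fun a => f₃.arr a (by simp [Program.arrs, sumLoop, forLoop])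
  clear f₃
  have hind' : IsIndicator (fun u => s.arr 5 ((X * n + v) * n + u)) (F X v) :=
    fun u => hF X hXK v u
  refine Triple.seq (Triple.sumLoop (N := n) (fun u => s.arr 5 ((X * n + v) * n + u)) (by decide)
    (by decide) (by decide) (by simp [r₃, r₁, h₀]) (by decide) ?_ ?_) ?_
  · intro _
    rw [hind'.sum]
    exact (card_le_of_fin _).trans hnM
  · intro j _ s' e₁ e₂ e₃
    simp [e₁, e₂, e₃, a₃, a₂, r₃, r₁, h₀, hv, q₁]
  intro s₄ f₄ q₄
  rw [hind'.sum] at q₄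
  have r₄ : ∀ x, x ≠ 25 → x ≠ 22 → s₄.reg x = s₃.reg x := fun x h h' =>
    (f₄.reg x (by simp [Program.regs, sumLoop, forLoop, h, h']))
  have a₄ : s₄.arr = s₂.arr := (funext fun a =>
    f₄.arr a (by simp [Program.arrs, sumLoop, forLoop])).trans a₃
  clear f₄
  refine Triple.ite (by decide) ?_ ?_
  · intro hlt
    have hlt' : S.card < (F X v).card := by
      by_contra h
      simp [q₄, r₄, q₃, h] at hlt
    refine (Triple.mapLoop (N := n) ((X * n + v) * n) (s₂.arr 11) (by decide)
      (by simp [r₄, r₃, r₁, h₀]) (by decide) (by decide) ?_).mono le_rfl ?_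
    · intro j _ s' e₁ e₂ e₃ _
      refine ⟨by simp [e₁, e₂, r₄, r₃, q₁, r₁, h₀, hv], by simp [e₁, e₃, a₄], fun b => ?_⟩
      rw [← a₄]
      exact b.arr _ _
    · rintro s₅ ⟨q₅, q₆⟩ X' hX' v' u'
      by_cases h : X' = X ∧ v' = v
      · obtain ⟨rfl, rfl⟩ := h
        rw [q₅ u' u'.2, hind u']
        rw [improve_self F hlt']
      · rw [q₆, a₄, a₂ 5 (by decide), hF X' hX' v' u', improve_of_ne F S h]
        intro j hj h'
        have := index_inj (u' := ⟨j, hj⟩) h'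
        exact h ⟨this.1, this.2.1⟩
  · intro hlt
    have hlt' : ¬ S.card < (F X v).card := by
      intro h
      simp [q₄, r₄, q₃, h] at hlt
    refine (Triple.skip (Q := HasTable T _) ?_).mono (by omega) (fun _ h => h)
    intro X' hX' v' u'
    rw [improve_of_not_lt F hlt', a₄, a₂ 5 (by decide), hF X' hX' v' u']

/-- One step of a round: the counter `15` encodes the two vertices and the two masks. -/
def relaxStep : Program :=
  .seq (.assign 17 (.reg 15 % .reg 0)) <|
  .seq (.assign 16 (.reg 15 / .reg 0 % .reg 0)) <|
  .seq (.assign 18 (.reg 15 / (.reg 0 * .reg 0) % .reg 12)) <|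
  .seq (.assign 19 (.reg 15 / (.reg 0 * .reg 0) / .reg 12)) <|
  .ite (.cell 0 (.reg 16 * .reg 0 + .reg 17)) relax .skip

/-- The invariant of a round: `F₀` is the table at its beginning. -/
structure RoundInv (G : Digraph (Fin n)) (R T : Finset (Fin n)) (F₀ : ℕ → Fin n → Finset (Fin n))
    (j : ℕ) (F : ℕ → Fin n → Finset (Fin n)) : Prop where
  sound : TableSound G R T F
  le : ∀ X < 2 ^ T.card, ∀ v, (F X v).card ≤ (F₀ X v).card
  done : ∀ i < j, ∀ v w : Fin n, w = i % n → v = i / n % n → G.Adj v w →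
    (F (maskUnion T (i / (n * n) % 2 ^ T.card) (i / (n * n) / 2 ^ T.card)) v).card ≤
      (F₀ (i / (n * n) % 2 ^ T.card) w).card + (F₀ (i / (n * n) / 2 ^ T.card) v).card +
        ({w} \ R).card

/-- Updating in place is harmless: entries only shrink during a round, so combining current entries
is at least as good as combining those of `F₀`. -/
theorem RoundInv.improve {G : Digraph (Fin n)} {R T : Finset (Fin n)}
    {F₀ F : ℕ → Fin n → Finset (Fin n)} {j : ℕ} (h : RoundInv G R T F₀ j F) {v w : Fin n}
    (hw : w = j % n) (hv : v = j / n % n) {Y Z : ℕ} (hY : Y = j / (n * n) % 2 ^ T.card)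
    (hZ : Z = j / (n * n) / 2 ^ T.card) (hYK : Y < 2 ^ T.card) (hZK : Z < 2 ^ T.card)
    (ha : G.Adj v w) :
    RoundInv G R T F₀ (j + 1) (improve F (maskUnion T Y Z) v (combine R F v w Y Z)) where
  sound X' hX' v' := by
    by_cases h' : X' = maskUnion T Y Z ∧ v' = v
    · obtain ⟨rfl, rfl⟩ := h'
      by_cases hlt : (combine R F v' w Y Z).card < (F (maskUnion T Y Z) v').card
      · rw [improve_self F hlt]; exact combine_sound h.sound ha hYK hZK
      · rw [improve_of_not_lt F hlt]; exact h.sound _ hX' _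
    · rw [improve_of_ne F _ h']; exact h.sound _ hX' _
  le X hX v := (card_improve_le _ _ _ _ _ _).trans (h.le X hX v)
  done i hi v' w' hw' hv' ha' := by
    rcases Nat.lt_succ_iff_lt_or_eq.1 hi with hi | rfl
    · exact (card_improve_le _ _ _ _ _ _).trans (h.done i hi v' w' hw' hv' ha')
    · obtain rfl : w' = w := Fin.ext (hw'.trans hw.symm)
      obtain rfl : v' = v := Fin.ext (hv'.trans hv.symm)
      subst hY hZ
      refine (card_improve_self_le _ _ _ _).trans ((card_combine_le _ _ _ _ _).trans ?_)
      have := h.le _ hYK w'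
      have := h.le _ hZK v'
      omega

theorem RoundInv.skip {G : Digraph (Fin n)} {R T : Finset (Fin n)}
    {F₀ F : ℕ → Fin n → Finset (Fin n)} {j : ℕ} (h : RoundInv G R T F₀ j F) {v w : Fin n}
    (hw : w = j % n) (hv : v = j / n % n) (ha : ¬ G.Adj v w) : RoundInv G R T F₀ (j + 1) F where
  sound := h.sound
  le := h.le
  done i hi v' w' hw' hv' ha' := by
    rcases Nat.lt_succ_iff_lt_or_eq.1 hi with hi | rfl
    · exact h.done i hi v' w' hw' hv' ha'
    · obtain rfl : w' = w := Fin.ext (hw'.trans hw.symm)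
      obtain rfl : v' = v := Fin.ext (hv'.trans hv.symm)
      exact absurd ha' ha

/-- With K masks, the combination of `v`, `w`, `Y`, `Z` is treated at counter value (ZK + Y)n² + vn
+ w. Decoding these mixed-radix digits yields what `TableComplete.succ` asks for. -/
theorem RoundInv.complete {G : Digraph (Fin n)} {R T : Finset (Fin n)}
    {F₀ F : ℕ → Fin n → Finset (Fin n)} {j : ℕ} (hc : TableComplete G R T j F₀)
    (h : RoundInv G R T F₀ (n * n * (2 ^ T.card * 2 ^ T.card)) F) :
    TableComplete G R T (j + 1) F := by
  refine hc.succ h.le fun v w ha Y hY Z hZ => ?_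
  have hn : 0 < n := v.pos
  set K := 2 ^ T.card with hK
  have hK0 : 0 < K := by positivity
  have e₁ : ((Z * K + Y) * (n * n) + (v * n + w)) % n = w := by
    rw [show (Z * K + Y) * (n * n) + (v * n + w) = n * ((Z * K + Y) * n + v) + w by ring,
      Nat.mul_add_mod, Nat.mod_eq_of_lt w.2]
  have e₂ : ((Z * K + Y) * (n * n) + (v * n + w)) / n % n = v := by
    rw [show (Z * K + Y) * (n * n) + (v * n + w) = n * (n * (Z * K + Y) + v) + w by ring,
      Nat.mul_add_div hn, Nat.div_eq_of_lt w.2, add_zero, Nat.mul_add_mod, Nat.mod_eq_of_lt v.2]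
  have hvw : (v * n + w : ℕ) < n * n := by
    have := v.2; have := w.2; nlinarith
  have e₃ : ((Z * K + Y) * (n * n) + (v * n + w)) / (n * n) = K * Z + Y := by
    rw [mul_comm _ (n * n), Nat.mul_add_div (by positivity), Nat.div_eq_of_lt hvw]; ring
  have e₄ : (K * Z + Y) % K = Y := by rw [Nat.mul_add_mod, Nat.mod_eq_of_lt hY]
  have e₅ : (K * Z + Y) / K = Z := by
    rw [Nat.mul_add_div hK0, Nat.div_eq_of_lt hY, add_zero]
  have hlt : (Z * K + Y) * (n * n) + (v * n + w) < n * n * (K * K) := by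
    have h₁ : Z * K + Y + 1 ≤ K * K := by nlinarith
    nlinarith [Nat.mul_le_mul_left (n * n) h₁]
  have := h.done _ hlt v w e₁.symm e₂.symm ha
  rwa [e₃, e₄, e₅] at this

theorem relaxStep_spec {M : ℕ} {s : Store} {G : Digraph (Fin n)} {r : Fin n}
    {R T : Finset (Fin n)} {F₀ F : ℕ → Fin n → Finset (Fin n)} {j : ℕ}
    (hG : HasGraph G r s) (hj : s.reg 15 = j) (hjK : j < n * n * (2 ^ T.card * 2 ^ T.card))
    (hK : s.reg 12 = 2 ^ T.card) (hR : IsIndicator (s.arr 3) R) (hT : HasBits T s)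
    (hF : HasTable T F s) (hI : RoundInv G R T F₀ j F) (hM : 2 ^ n ≤ M) :
    Triple M relaxStep s (35 * n) (fun s' => ∃ F', HasTable T F' s' ∧
      RoundInv G R T F₀ (j + 1) F') := by
  have hn : 0 < n := r.pos
  have hnM : n ≤ M := (Nat.lt_two_pow_self).le.trans hM
  have hKM : 2 ^ T.card ≤ M := (Nat.pow_le_pow_right (by omega) (card_le_of_fin _)).trans hM
  have hK0 : 0 < 2 ^ T.card := by positivity
  have hs := hG.size
  refine Triple.mono (k := 1 + (1 + (1 + (1 + (30 * n + 1))))) ?_ (by omega) (fun _ h => h)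
  refine Triple.seq (Q' := fun s' => s' = s.setReg 17 (j % n)) (Triple.assign (by decide)
    (fun _ => ?_) (by simp [hj, hs])) ?_
  · have := Nat.mod_lt j hn
    simp [hj, hs]; omega
  rintro _ - rfl
  refine Triple.seq (Q' := fun s' => s' = (s.setReg 17 (j % n)).setReg 16 (j / n % n))
    (Triple.assign (by decide) (fun _ => ?_) (by simp [hj, hs])) ?_
  · have := Nat.mod_lt (j / n) hn
    simp [hj, hs]; omega
  rintro _ - rfl
  refine Triple.seq (Q' := fun s' => s' = ((s.setReg 17 (j % n)).setReg 16 (j / n % n)).setReg 18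
    (j / (n * n) % 2 ^ T.card))
    (Triple.assign (by decide) (fun _ => ?_) (by simp [hj, hs, hK])) ?_
  · have := Nat.mod_lt (j / (n * n)) hK0
    simp [hj, hs, hK]; omega
  rintro _ - rfl
  -- The leading digit needs no reduction, as the counter is below n² times the square of the number
  -- of masks.
  have hZ : j / (n * n) / 2 ^ T.card < 2 ^ T.card := by
    rw [Nat.div_lt_iff_lt_mul hK0, Nat.div_lt_iff_lt_mul (by positivity)]
    linarith [mul_comm (n * n) (2 ^ T.card * 2 ^ T.card)]
  refine Triple.seq (Q' := fun s' => s' = (((s.setReg 17 (j % n)).setReg 16 (j / n % n)).setReg 18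
    (j / (n * n) % 2 ^ T.card)).setReg 19 (j / (n * n) / 2 ^ T.card))
    (Triple.assign (by decide) (fun _ => ?_) (by simp [hj, hs, hK])) ?_
  · simp only [Term.eval_div, Term.eval_mul, Term.eval_reg, Store.setReg_reg]
    simp [hj, hs, hK]; omega
  rintro s₄ - h₄
  have a₄ : s₄.arr = s.arr := by rw [h₄]; rfl
  let v : Fin n := ⟨j / n % n, Nat.mod_lt _ hn⟩
  let w : Fin n := ⟨j % n, Nat.mod_lt _ hn⟩
  have hadj : s₄.arr 0 (v * n + w) ≠ 0 ↔ G.Adj v w := by rw [a₄]; exact hG.adj v w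
  have e₁ : s₄.reg 16 = v := by simp [h₄, v]
  have e₂ : s₄.reg 17 = w := by simp [h₄, w]
  have e₃ : s₄.reg 0 = n := by simp [h₄, hs]
  refine Triple.ite (by decide) (fun h => ?_) (fun h => ?_)
  · have ha : G.Adj v w := hadj.1 (by simpa [e₁, e₂, e₃] using h)
    refine (relax_spec (s := s₄) (v := v) (w := w) (Y := j / (n * n) % 2 ^ T.card)
      (Z := j / (n * n) / 2 ^ T.card) e₃ e₁ e₂ (by simp [h₄]) (by simp [h₄])
      (Nat.mod_lt _ hK0) hZ (by rwa [a₄]) (by rwa [HasBits, a₄]) (by rwa [HasTable, a₄])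
      hM).mono le_rfl fun s' h' => ⟨_, h', ?_⟩
    exact hI.improve rfl rfl rfl rfl (Nat.mod_lt _ hK0) hZ ha
  · have ha : ¬ G.Adj v w := fun ha => hadj.2 ha (by simpa [e₁, e₂, e₃] using h)
    exact (Triple.skip ⟨F, by rwa [HasTable, a₄], hI.skip rfl rfl ha⟩).mono (by omega)
      (fun _ h => h)

/-- All rounds. -/
def rounds : Program := forLoop 13 0 (forLoop 15 14 relaxStep)

/-- Since no solution has more than n vertices, n rounds suffice. Each costs O(n) per arc candidate
and pair of masks; the pairs cause the square of 2^|T|. -/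
theorem rounds_spec {M : ℕ} {s : Store} {G : Digraph (Fin n)} {r : Fin n}
    {R T : Finset (Fin n)} {F : ℕ → Fin n → Finset (Fin n)}
    (hG : HasGraph G r s) (hQ : s.reg 14 = n * n * (2 ^ T.card * 2 ^ T.card))
    (hK : s.reg 12 = 2 ^ T.card) (hR : IsIndicator (s.arr 3) R) (hT : HasBits T s)
    (hF : HasTable T F s) (hs : TableSound G R T F) (hc : TableComplete G R T 0 F)
    (hM : 2 ^ n ≤ M) :
    Triple M rounds s (45 * n ^ 4 * (2 ^ T.card) ^ 2) (fun s' => ∃ F', HasTable T F' s' ∧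
      TableSound G R T F' ∧ TableComplete G R T n F') := by
  have hn : 1 ≤ n := r.pos
  have hK1 : 1 ≤ 2 ^ T.card := Nat.one_le_two_pow
  refine Triple.mono (k := n * ((n * n * (2 ^ T.card * 2 ^ T.card) * (35 * n + 2) + 2) + 2) + 2)
    (Triple.forLoop (fun j s' => ∃ F', HasTable T F' s' ∧ TableSound G R T F' ∧
      TableComplete G R T j F') (by decide) (by decide) (by decide) hG.size ?_ ⟨F, hF, hs, hc⟩ ?_)
    ?_ (fun _ h => h)
  · exact fun _ _ _ h => h
  · rintro j hj s₁ e₁ e₂ e₃ ⟨F₁, h₁, h₂, h₃⟩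
    have r₁ : ∀ x < 13, s₁.reg x = s.reg x := fun x hx =>
      e₂ x (by omega) (by simp [Program.regs, forLoop, relaxStep, relax, sumLoop, mapLoop]; omega)
    have r₂ : s₁.reg 14 = s.reg 14 := e₂ 14 (by decide) (by decide)
    have a₁ : ∀ a < 5, s₁.arr a = s.arr a := fun a ha =>
      e₃ a (by simp [Program.arrs, forLoop, relaxStep, relax, sumLoop, mapLoop]; omega)
    refine (Triple.forLoop (k := 35 * n) (fun i s' => ∃ F', HasTable T F' s' ∧
      RoundInv G R T F₁ i F') (by decide) (by decide) (by decide) (r₂.trans hQ)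
      (fun _ _ _ h => h) ⟨F₁, h₁, h₂, fun _ _ _ => le_rfl, by simp⟩ ?_).mono le_rfl ?_
    · rintro i hi s₂ f₁ f₂ f₃ ⟨F₂, g₁, g₂⟩
      have r₃ : ∀ x < 13, s₂.reg x = s.reg x := fun x hx =>
        (f₂ x (by omega) (by simp [Program.regs, forLoop, relaxStep, relax, sumLoop, mapLoop];
                             omega)).trans (r₁ x hx)
      have a₂ : ∀ a < 5, s₂.arr a = s.arr a := fun a ha =>
        (f₃ a (by simp [Program.arrs, forLoop, relaxStep, relax, sumLoop, mapLoop];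
                  omega)).trans (a₁ a ha)
      refine relaxStep_spec (hG.of_eq (r₃ 0 (by omega)) (r₃ 1 (by omega)) (a₂ 0 (by omega))) f₁ hi
        ((r₃ 12 (by omega)).trans hK) ?_ ?_ g₁ g₂ hM
      · rw [a₂ 3 (by omega)]; exact hR
      · rw [HasBits, a₂ 4 (by omega)]; exact hT
    · rintro s₂ ⟨F₂, g₁, g₂⟩
      exact ⟨F₂, g₁, g₂.sound, g₂.complete h₃⟩
  · generalize 2 ^ T.card = K at hK1
    have h₁ : 1 ≤ n ^ 4 * K ^ 2 := Nat.mul_pos (by positivity) (by positivity)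
    have h₂ : n ≤ n ^ 4 * K ^ 2 :=
      (Nat.le_self_pow (by omega) n).trans (Nat.le_mul_of_pos_right _ (by positivity))
    have h₃ : n ^ 3 * K ^ 2 ≤ n ^ 4 * K ^ 2 :=
      Nat.mul_le_mul_right _ (Nat.pow_le_pow_right hn (by omega))
    calc n * (n * n * (K * K) * (35 * n + 2) + 2 + 2) + 2
        = 35 * (n ^ 4 * K ^ 2) + 2 * (n ^ 3 * K ^ 2) + 4 * n + 2 := by ring
      _ ≤ 45 * (n ^ 4 * K ^ 2) := by omega
      _ = 45 * n ^ 4 * K ^ 2 := by ring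

end RAM

/-! ### The exact Steiner subroutine -/

namespace RAM

variable {n : ℕ}

/-- The smallest set of Steiner vertices by which the root reaches all vertices in array `12`,
when the vertices in array `3` are free. The result is stored in array `10`. -/
def steiner : Program :=
  .seq (.assign 12 1) <|
  .seq bitLoop <|
  .seq (.assign 24 (.reg 0 * .reg 0 * .reg 12)) <|
  .seq (mapLoop 25 24 5 (.reg 25) (Term.less 0 (.reg 25 / (.reg 0 * .reg 0)) *
    (1 - Term.same (.reg 25 / (.reg 0 * .reg 0)) (.cell 4 (.reg 25 / .reg 0 % .reg 0))))) <|
  .seq (.assign 14 (.reg 0 * .reg 0 * (.reg 12 * .reg 12))) <|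
  .seq rounds <|
  .seq (sumLoop 25 0 23 (.cell 4 (.reg 25)))
    (mapLoop 25 0 10 (.reg 25) (.cell 5 ((.reg 23 * .reg 0 + .reg 1) * .reg 0 + .reg 25)))

theorem steiner_regs {x : ℕ} (hx : x < 12) : x ∉ steiner.regs := by
  simp [Program.regs, steiner, bitLoop, rounds, forLoop, relaxStep, relax, sumLoop, mapLoop]
  omega

theorem steiner_arrs {a : ℕ} (ha : a ≠ 4) (ha' : a ≠ 5) (ha'' : a ≠ 10) (ha''' : a ≠ 11) :
    a ∉ steiner.arrs := by
  simp [Program.arrs, steiner, bitLoop, rounds, forLoop, relaxStep, relax, sumLoop, mapLoop]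
  omega

/-- The bound required of M covers the number of combinations in one round, which is kept in a
register as a loop limit. -/
theorem steiner_spec {M : ℕ} {s : Store} {G : Digraph (Fin n)} {r : Fin n} {R T : Finset (Fin n)}
    (hG : HasGraph G r s) (hR : IsIndicator (s.arr 3) R) (hT : IsIndicator (s.arr 12) T)
    (hM : n * n * (2 ^ n * 2 ^ n) ≤ M) :
    Triple M steiner s (80 * n ^ 4 * (2 ^ T.card) ^ 2)
      (fun s' => ∃ P, IsIndicator (s'.arr 10) P ∧ IsSteinerMin G r R T P) := by
  have hn : 1 ≤ n := r.pos
  have hK1 : 1 ≤ 2 ^ T.card := Nat.one_le_two_pow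
  have hKn : 2 ^ T.card ≤ 2 ^ n := Nat.pow_le_pow_right (by omega) (card_le_of_fin _)
  have hn2 : 1 ≤ n * n := Nat.mul_pos hn hn
  have hM' : 2 ^ n ≤ M := by nlinarith [Nat.one_le_two_pow (n := n)]
  have hQM : n * n * (2 ^ T.card * 2 ^ T.card) ≤ M :=
    (Nat.mul_le_mul_left _ (Nat.mul_le_mul hKn hKn)).trans hM
  refine Triple.mono (k := 1 + ((n * 4 + 2) + (1 + ((n * n * 2 ^ T.card * 3 + 2) + (1 +
    (45 * n ^ 4 * (2 ^ T.card) ^ 2 + ((n * 3 + 3) + (n * 3 + 2)))))))) ?_ ?_ (fun _ h => h)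
  · refine Triple.seq (Q' := fun s' => s'.reg 12 = 1) (Triple.assign (by decide) (fun b => ?_)
      (by simp)) ?_
    · have := b.two_le; simp; omega
    intro s₁ f₁ q₁
    have e₁ : s₁.reg 0 = n := by rw [f₁.reg 0 (by decide), hG.size]
    refine Triple.seq (bitLoop_spec (T := T) e₁ q₁ (by rw [f₁.arr 12 (by decide)]; exact hT) hM') ?_
    rintro s₂ f₂ ⟨q₂, q₂'⟩
    have e₂ : s₂.reg 0 = n := by rw [f₂.reg 0 (by decide), e₁]
    refine Triple.seq (Q' := fun s' => s'.reg 24 = n * n * 2 ^ T.card) (Triple.assign (by decide)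
      (fun b => ?_) (by simp [e₂, q₂])) ?_
    · simp only [Term.eval_mul, Term.eval_reg, e₂, q₂]
      refine le_trans ?_ hQM
      exact Nat.mul_le_mul_left _ (Nat.le_mul_of_pos_left _ (by omega))
    intro s₃ f₃ q₃
    have e₃ : s₃.reg 0 = n := by rw [f₃.reg 0 (by decide), e₂]
    have b₃ : HasBits T s₃ := by rw [HasBits, f₃.arr 4 (by decide)]; exact q₂'
    refine Triple.seq (Triple.mapLoop 0 (fun q => (if 0 < q / (n * n) then 1 else 0) *
      (1 - (if q / (n * n) = s₃.arr 4 (q / n % n) then 1 else 0)))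
      (by decide) q₃ (by decide) (by decide) ?_) ?_
    · intro j _ s' g₁ g₂ g₃ _
      refine ⟨by simp [g₁], by simp [g₁, g₂, g₃, e₃], fun b => ?_⟩
      have := b.two_le
      split_ifs <;> omega
    rintro s₄ f₄ ⟨q₄, -⟩
    have e₄ : s₄.reg 0 = n := by rw [f₄.reg 0 (by decide), e₃]
    have k₄ : s₄.reg 12 = 2 ^ T.card := by
      rw [f₄.reg 12 (by decide), f₃.reg 12 (by decide), q₂]
    have b₄ : HasBits T s₄ := by rw [HasBits, f₄.arr 4 (by decide)]; exact b₃
    -- The mask and the start vertex are recovered from the cell index. The lowest digit is ignored,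
    -- because an initial entry is either empty or everything.
    have t₄ : HasTable T (tableInit T) s₄ := by
      intro X hX v u
      have hvu : (v * n + u : ℕ) < n * n := by have := v.2; have := u.2; nlinarith
      have hi : (X * n + v) * n + u = n * n * X + (v * n + u) := by ring
      have d₁ : ((X * n + v) * n + u) / (n * n) = X := by
        rw [hi, Nat.mul_add_div (by positivity), Nat.div_eq_of_lt hvu, add_zero]
      have d₂ : ((X * n + v) * n + u) / n % n = v := by
        rw [mul_comm _ n, Nat.mul_add_div hn, Nat.div_eq_of_lt u.2, add_zero, mul_comm X,
          Nat.mul_add_mod, Nat.mod_eq_of_lt v.2]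
      have hlt : (X * n + v) * n + u < n * n * 2 ^ T.card := by
        have := Nat.mul_le_mul_left (n * n) (Nat.succ_le_of_lt hX)
        rw [hi]
        rw [Nat.mul_succ] at this
        omega
      have := q₄ _ hlt
      rw [zero_add] at this
      rw [this, d₁, d₂, b₃ v, tableInit]
      by_cases c₁ : X = 0
      · simp [c₁]
      · by_cases c₂ : X = bitOf T v
        · simp [c₂]
        · simp [c₁, c₂, Nat.pos_of_ne_zero c₁]
    refine Triple.seq (Q' := fun s' => s'.reg 14 = n * n * (2 ^ T.card * 2 ^ T.card))
      (Triple.assign (by decide) (fun b => ?_) (by simp [e₄, k₄])) ?_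
    · simpa only [Term.eval_mul, Term.eval_reg, e₄, k₄] using hQM
    intro s₅ f₅ q₅
    have r₅ : ∀ x < 12, s₅.reg x = s.reg x := by
      intro x hx
      rw [f₅.reg, f₄.reg, f₃.reg, f₂.reg, f₁.reg] <;>
        simp [Program.regs, mapLoop, forLoop, bitLoop] <;> omega
    have a₅ : ∀ a < 4, s₅.arr a = s.arr a := by
      intro x hx
      rw [f₅.arr, f₄.arr, f₃.arr, f₂.arr, f₁.arr] <;>
        simp [Program.arrs, mapLoop, forLoop, bitLoop] <;> omega
    refine Triple.seq (rounds_spec (R := R) (hG.of_eq (r₅ 0 (by omega)) (r₅ 1 (by omega))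
      (a₅ 0 (by omega))) q₅ (by rw [f₅.reg 12 (by decide), k₄]) (by rw [a₅ 3 (by omega)]; exact hR)
      (by rw [HasBits, f₅.arr 4 (by decide)]; exact b₄)
      (by rw [HasTable, f₅.arr 5 (by decide)]; exact t₄)
      tableInit_sound tableInit_complete hM') ?_
    rintro s₆ f₆ ⟨F, q₆, q₇, q₈⟩
    have e₆ : s₆.reg 0 = n := by rw [f₆.reg 0 (by decide), r₅ 0 (by omega), hG.size]
    have b₆ : HasBits T s₆ := by
      rw [HasBits, f₆.arr 4 (by decide), f₅.arr 4 (by decide)]; exact b₄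
    have hsum : ∑ j ∈ Finset.range n, s₆.arr 4 j = maskOf T T := by
      rw [Finset.sum_range, maskOf, ← Finset.sum_subset (Finset.subset_univ T)]
      · exact Finset.sum_congr rfl fun u _ => b₆ u
      · intro u _ hu; rw [b₆ u, bitOf, if_neg hu]
    have hfull : maskOf T T < 2 ^ T.card := maskOf_lt le_rfl
    refine Triple.seq (Triple.sumLoop (s₆.arr 4) (by decide) (by decide) (by decide) e₆ (by decide)
      (fun _ => by omega) ?_) ?_
    · intro j _ s' g₁ g₂ g₃
      simp [g₁, g₃]
    intro s₇ f₇ q₉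
    have e₇ : s₇.reg 0 = n := by rw [f₇.reg 0 (by decide), e₆]
    have e₇' : s₇.reg 1 = r := by
      rw [f₇.reg 1 (by decide), f₆.reg 1 (by decide), r₅ 1 (by omega), hG.root]
    refine (Triple.mapLoop 0 (fun u => s₆.arr 5 ((maskOf T T * n + r) * n + u)) (by decide) e₇
      (by decide) (by decide) ?_).mono le_rfl ?_
    · intro j _ s' g₁ g₂ g₃ _
      refine ⟨by simp [g₁], by simp [g₁, g₂, g₃, e₇, e₇', q₉, hsum, f₇.arr 5 (by decide)],
        fun b => ?_⟩
      rw [← f₇.arr 5 (by decide)]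
      exact b.arr _ _
    · rintro s₈ ⟨q₁₀, -⟩
      refine ⟨F (maskOf T T) r, fun u => ?_,
        table_optimal q₇ (by rwa [Fintype.card_fin]) r⟩
      have := q₁₀ u u.2
      rw [zero_add] at this
      rw [this, q₆ _ hfull]
  · generalize 2 ^ T.card = K at hK1
    have h₁ : 1 ≤ n ^ 4 * K ^ 2 := Nat.mul_pos (by positivity) (by positivity)
    have h₂ : n ≤ n ^ 4 * K ^ 2 :=
      (Nat.le_self_pow (by omega) n).trans (Nat.le_mul_of_pos_right _ (by positivity))
    have h₃ : n ^ 2 * K ≤ n ^ 4 * K ^ 2 :=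
      Nat.mul_le_mul (Nat.pow_le_pow_right hn (by omega)) (Nat.le_self_pow (by omega) _)
    have h₄ : n * n * K = n ^ 2 * K := by ring
    have h₅ : 80 * n ^ 4 * K ^ 2 = 80 * (n ^ 4 * K ^ 2) := by ring
    have h₆ : 45 * n ^ 4 * K ^ 2 = 45 * (n ^ 4 * K ^ 2) := by ring
    rw [h₄, h₅, h₆]
    omega

end RAM

/-! ### Growing an arborescence -/

section Tree

variable {V : Type*} {G : Digraph V} {W : Finset V} {r : V} {T : ArcGraph V}

/-- `T` is an arborescence of vertices that are reached from `r` in `W`. -/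
structure IsTreeIn (G : Digraph V) (W : Finset V) (r : V) (T : ArcGraph V) : Prop where
  subgraph : T.IsSubgraphOf G
  arborescence : T.IsArborescence r
  card : T.arcs.card + 1 = T.verts.card
  reach : ∀ v ∈ T.verts, ReachIn G W r v

theorem isTreeIn_singleton : IsTreeIn G W r ⟨{r}, ∅⟩ where
  subgraph a ha := by simp at ha
  arborescence :=
    ⟨by simp, by simp, fun v hv h => absurd (by simpa using hv) h, fun v hv => by
      obtain rfl : v = r := by simpa using hv
      exact .refl⟩
  card := by simp
  reach v hv := by
    obtain rfl : v = r := by simpa using hv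
    exact .refl _ _

variable [DecidableEq V]

theorem IsTreeIn.insert (h : IsTreeIn G W r T) {u v : V} (hu : u ∈ T.verts) (hv : v ∉ T.verts)
    (hW : v ∈ W) (ha : G.Adj u v) : IsTreeIn G W r ⟨insert v T.verts, insert (u, v) T.arcs⟩ where
  subgraph := by
    intro a ha'
    rcases Finset.mem_insert.1 ha' with rfl | ha'
    · exact ⟨by simp [hu], by simp, ha⟩
    · obtain ⟨h₁, h₂, h₃⟩ := h.subgraph a ha'
      exact ⟨by simp [h₁], by simp [h₂], h₃⟩
  arborescence := by
    have hvr : v ≠ r := fun h' => hv (h' ▸ h.arborescence.root_mem)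
    refine ⟨by simp [h.arborescence.root_mem], fun w hw => ?_, fun w hw hwr => ?_, fun w hw => ?_⟩
    · rcases Finset.mem_insert.1 hw with hw | hw
      · exact hvr (Prod.ext_iff.1 hw).2.symm
      · exact h.arborescence.root_inDegree w hw
    · rcases Finset.mem_insert.1 hw with rfl | hw
      · refine ⟨u, by simp, fun u' hu' => ?_⟩
        rcases Finset.mem_insert.1 hu' with hu' | hu'
        · exact (Prod.ext_iff.1 hu').1
        · exact absurd (h.subgraph _ hu').2.1 hv
      · obtain ⟨x, hx, hx'⟩ := h.arborescence.inDegree w hw hwr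
        refine ⟨x, by simp [hx], fun y hy => ?_⟩
        rcases Finset.mem_insert.1 hy with hy | hy
        · exact absurd (show w = v from (Prod.ext_iff.1 hy).2) (fun h' => hv (h' ▸ hw))
        · exact hx' y hy
    · have key : ∀ w ∈ T.verts,
          Relation.ReflTransGen (fun a b => (a, b) ∈ Insert.insert (u, v) T.arcs) r w :=
        fun w hw => Relation.ReflTransGen.mono (r := fun a b => (a, b) ∈ T.arcs)
          (fun a b hab => Finset.mem_insert_of_mem hab) _ _ (h.arborescence.reachable w hw)
      rcases Finset.mem_insert.1 hw with rfl | hw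
      · exact (key u hu).tail (by simp)
      · exact key w hw
  card := by
    have : (u, v) ∉ T.arcs := fun h' => hv (h.subgraph _ h').2.1
    simp only [Finset.card_insert_of_notMem this, Finset.card_insert_of_notMem hv, h.card]
  reach w hw := by
    rcases Finset.mem_insert.1 hw with rfl | hw
    · exact (h.reach u hu).step ha hW
    · exact h.reach w hw

/-- A walk from `r` to `v ≠ r` in `A` has a part that ends at an in-neighbour of `v`, before `v`
is visited. -/
theorem ReachIn.exists_pred {A : Finset V} {v : V} (h : ReachIn G A r v) (hv : v ≠ r) :
    v ∈ A ∧ ∃ u, ReachIn G (A.erase v) r u ∧ G.Adj u v := by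
  have key : ∀ c, ReachIn G A r c →
      ReachIn G (A.erase v) r c ∨ ∃ u, ReachIn G (A.erase v) r u ∧ G.Adj u v := by
    intro c hc
    induction hc with
    | refl => exact .inl (.refl _ _)
    | @tail b c _ hbc ih =>
      rcases ih with ih | ih
      · by_cases hcv : c = v
        · exact .inr ⟨b, ih, hcv ▸ hbc.1⟩
        · exact .inl (ih.step hbc.1 (Finset.mem_erase.2 ⟨hcv, hbc.2⟩))
      · exact .inr ih
  refine ⟨h.mem.resolve_left hv, ?_⟩
  rcases key v h with h' | h'
  · rcases h'.mem with h' | h'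
    · exact absurd h' hv
    · simp at h'
  · exact h'

end Tree

/-! ### Growing the tree on the machine -/

namespace RAM

variable {n : ℕ}

/-- Array `6` holds the vertices, and array `2` the arcs, of `T`. -/
structure HasTree (T : ArcGraph (Fin n)) (s : Store) : Prop where
  verts : IsIndicator (s.arr 6) T.verts
  arcs : OutputIs s T

/-- Add the arc that is encoded by the counter `27` to the tree, if it leads to a new vertex. -/
def growStep : Program :=
  .ite (.cell 6 (.reg 27 / .reg 0) * (1 - .cell 6 (.reg 27 % .reg 0)) *
      .cell 13 (.reg 27 % .reg 0) * .cell 0 (.reg 27))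
    (.seq (.store 6 (.reg 27 % .reg 0) 1) (.store 2 (.reg 27) 1)) .skip

/-- Grow a tree that spans all vertices that are reached from the root in the vertex set held by
array `13`. -/
def grow : Program :=
  .seq (.assign 28 (.reg 0 * .reg 0)) <|
  .seq (mapLoop 25 28 2 (.reg 25) 0) <|
  .seq (mapLoop 25 0 6 (.reg 25) (Term.same (.reg 25) (.reg 1))) <|
  forLoop 26 0 (forLoop 27 28 growStep)

theorem grow_regs {x : ℕ} (hx : x < 25) : x ∉ grow.regs := by
  simp [Program.regs, grow, growStep, forLoop, mapLoop]
  omega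

theorem grow_arrs {a : ℕ} (ha : a ≠ 2) (ha' : a ≠ 6) : a ∉ grow.arrs := by
  simp [Program.arrs, grow, growStep, forLoop, mapLoop]
  omega

theorem pair_inj {v v' u u' : Fin n} (h : (v * n + u : ℕ) = v' * n + u') : v = v' ∧ u = u' := by
  have := index_inj (X := 0) (X' := 0) (v := v) (v' := v') (u := u) (u' := u') (by simpa using h)
  exact this.2

/-- The invariant of a round: `T₀` is the tree at its beginning. -/
structure GrowInv (G : Digraph (Fin n)) (W : Finset (Fin n)) (r : Fin n) (T₀ : ArcGraph (Fin n))
    (j : ℕ) (T : ArcGraph (Fin n)) : Prop where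
  tree : IsTreeIn G W r T
  le : T₀.verts ⊆ T.verts
  done : ∀ u v : Fin n, (u * n + v : ℕ) < j → u ∈ T₀.verts → G.Adj u v → v ∈ W → v ∈ T.verts

theorem growStep_spec {M : ℕ} {s : Store} {G : Digraph (Fin n)} {r : Fin n} {W : Finset (Fin n)}
    {T₀ T : ArcGraph (Fin n)} {j : ℕ} (hG : HasGraph G r s) (hj : s.reg 27 = j) (hjn : j < n * n)
    (hW : IsIndicator (s.arr 13) W) (hT : HasTree T s) (hI : GrowInv G W r T₀ j T) :
    Triple M growStep s 3 (fun s' => ∃ T', HasTree T' s' ∧ GrowInv G W r T₀ (j + 1) T') := by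
  have hn : 0 < n := r.pos
  obtain ⟨u, v, huv⟩ : ∃ u v : Fin n, (u * n + v : ℕ) = j :=
    ⟨⟨j / n, Nat.div_lt_of_lt_mul hjn⟩, ⟨j % n, Nat.mod_lt _ hn⟩, by
      simpa [mul_comm] using Nat.div_add_mod j n⟩
  have d₁ : j / n = u := by
    rw [← huv, mul_comm, Nat.mul_add_div hn, Nat.div_eq_of_lt v.2, add_zero]
  have d₂ : j % n = v := by rw [← huv, mul_comm, Nat.mul_add_mod, Nat.mod_eq_of_lt v.2]
  have hs := hG.size
  have hev : (Term.cell 6 (.reg 27 / .reg 0) * (1 - .cell 6 (.reg 27 % .reg 0)) *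
      .cell 13 (.reg 27 % .reg 0) * .cell 0 (.reg 27)).eval s ≠ 0 ↔
      (u ∈ T.verts ∧ v ∉ T.verts ∧ v ∈ W ∧ G.Adj u v) := by
    rw [← hG.adj u v, huv]
    simp only [Term.eval_mul, Term.eval_cell, Term.eval_sub, Term.eval_div, Term.eval_mod,
      Term.eval_reg, Term.eval_one, hj, hs, d₁, d₂, hT.verts u, hT.verts v, hW v]
    by_cases c₁ : u ∈ T.verts <;> by_cases c₂ : v ∈ T.verts <;> by_cases c₃ : v ∈ W <;>
      simp [c₁, c₂, c₃]
  refine Triple.ite (k := 2) (by decide) (fun h => ?_) (fun h => ?_)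
  · obtain ⟨hu, hv, hvW, ha⟩ := hev.1 h
    refine Triple.seq (k₁ := 1) (k₂ := 1) (Q' := fun s' => s' = s.setCell 6 v 1)
      (Triple.store (by decide) (by decide) (fun b => ?_) (by simp [hj, hs, d₂])) ?_
    · have := b.two_le; simp; omega
    rintro _ - rfl
    refine Triple.store (by decide) (by decide) (fun b => ?_) ⟨_, ⟨?_, ?_⟩,
      ⟨hI.tree.insert hu hv hvW ha, hI.le.trans (Finset.subset_insert _ _), ?_⟩⟩
    · have := b.two_le; simp; omega
    · intro w
      have := hT.verts w
      by_cases hw : w = v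
      · simp [hw]
      · have hw' : (w : ℕ) ≠ v := fun h => hw (Fin.ext h)
        simp [hw, hw', this]
    · intro a b
      have := hT.arcs a b
      by_cases hab : (a * n + b : ℕ) = j
      · obtain ⟨rfl, rfl⟩ := pair_inj (hab.trans huv.symm)
        simp [hj, hab]
      · have : ¬ (a = u ∧ b = v) := fun h => hab (by rw [h.1, h.2, huv])
        simp [hj, hab, this, ‹_ ↔ _›]
    · intro a b hab ha' hadj hb
      rcases Nat.lt_succ_iff_lt_or_eq.1 hab with hab | hab
      · exact Finset.mem_insert_of_mem (hI.done a b hab ha' hadj hb)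
      · obtain ⟨rfl, rfl⟩ := pair_inj (hab.trans huv.symm)
        simp
  · refine (Triple.skip ⟨T, hT, hI.tree, hI.le, ?_⟩).mono (by omega) (fun _ h => h)
    intro a b hab ha' hadj hb
    rcases Nat.lt_succ_iff_lt_or_eq.1 hab with hab | hab
    · exact hI.done a b hab ha' hadj hb
    · obtain ⟨rfl, rfl⟩ := pair_inj (hab.trans huv.symm)
      by_contra hbT
      exact hev.2 ⟨hI.le ha', hbT, hb, hadj⟩ h

/-- After `j` rounds the tree contains all vertices reached from `r` inside some subset of `W` of
size at most `j`. Indeed, by `ReachIn.exists_pred`, some in-neighbour of `v` is reached without `v`,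
hence with one vertex less, and so belongs to the tree one round earlier. -/
theorem grow_spec {M : ℕ} {s : Store} {G : Digraph (Fin n)} {r : Fin n} {W : Finset (Fin n)}
    (hG : HasGraph G r s) (hW : IsIndicator (s.arr 13) W) (hM : n * n ≤ M) :
    Triple M grow s (30 * n ^ 3) (fun s' => ∃ T, HasTree T s' ∧ IsTreeIn G W r T ∧
      ∀ v, v ∈ T.verts ↔ ReachIn G W r v) := by
  have hn : 1 ≤ n := r.pos
  refine Triple.mono (k := 1 + ((n * n * 3 + 2) + ((n * 3 + 2) +
    (n * ((n * n * (3 + 2) + 2) + 2) + 2)))) ?_ ?_ (fun _ h => h)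
  · refine Triple.seq (Q' := fun s' => s'.reg 28 = n * n) (Triple.assign (by decide)
      (fun _ => by simpa [hG.size] using hM) (by simp [hG.size])) ?_
    intro s₁ f₁ q₁
    refine Triple.seq (Triple.mapLoop 0 (fun _ => 0) (by decide) q₁ (by decide) (by decide) ?_) ?_
    · intro j _ s' g₁ _ _ _
      simp [g₁]
    rintro s₂ f₂ ⟨q₂, -⟩
    have e₂ : s₂.reg 0 = n := by rw [f₂.reg 0 (by decide), f₁.reg 0 (by decide), hG.size]
    have e₂' : s₂.reg 1 = r := by rw [f₂.reg 1 (by decide), f₁.reg 1 (by decide), hG.root]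
    refine Triple.seq (Triple.mapLoop 0 (fun u => if u = r then 1 else 0) (by decide) e₂ (by decide)
      (by decide) ?_) ?_
    · intro j _ s' g₁ g₂ _ _
      refine ⟨by simp [g₁], by simp [g₁, g₂, e₂'], fun b => ?_⟩
      have := b.two_le
      split_ifs <;> omega
    rintro s₃ f₃ ⟨q₃, -⟩
    have r₃ : ∀ x < 25, s₃.reg x = s.reg x := by
      intro x hx
      rw [f₃.reg, f₂.reg, f₁.reg] <;> simp [Program.regs, mapLoop, forLoop] <;> omega
    have a₃ : ∀ a, a ≠ 2 → a ≠ 6 → s₃.arr a = s.arr a := by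
      intro x hx hx'
      rw [f₃.arr, f₂.arr, f₁.arr] <;> simp [Program.arrs, mapLoop, forLoop] <;> omega
    have e₃ : s₃.reg 28 = n * n := by rw [f₃.reg 28 (by decide), f₂.reg 28 (by decide), q₁]
    have t₃ : HasTree ⟨{r}, ∅⟩ s₃ := by
      refine ⟨fun u => ?_, fun u v => ?_⟩
      · have := q₃ u u.2
        rw [zero_add] at this
        simp [this, Fin.ext_iff]
      · have hlt : (u * n + v : ℕ) < n * n := by have := u.2; have := v.2; nlinarith
        have := q₂ _ hlt
        rw [zero_add] at this
        simp [f₃.arr 2 (by decide), this]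
    refine (Triple.forLoop (k := n * n * (3 + 2) + 2) (fun j s' => ∃ T, HasTree T s' ∧
      IsTreeIn G W r T ∧ ∀ A ⊆ W, A.card ≤ j → ∀ v, ReachIn G A r v → v ∈ T.verts) (by decide)
      (by decide) (by decide) ((r₃ 0 (by omega)).trans hG.size)
      (fun _ _ _ ⟨T, h₁, h₂⟩ => ⟨T, ⟨h₁.1, h₁.2⟩, h₂⟩)
      ⟨_, t₃, isTreeIn_singleton, ?_⟩ ?_).mono le_rfl ?_
    · intro A _ hA v hv
      obtain rfl : A = ∅ := by simpa using hA
      simpa using hv.mem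
    · rintro j _ s₄ - r₄ a₄ ⟨T₀, t₀, t₁, t₂⟩
      refine (Triple.forLoop (k := 3) (fun i s' => ∃ T, HasTree T s' ∧ GrowInv G W r T₀ i T)
        (by decide) (by decide) (by decide) ((r₄ 28 (by decide) (by decide)).trans e₃)
        (fun _ _ _ ⟨T, h₁, h₂⟩ => ⟨T, ⟨h₁.1, h₁.2⟩, h₂⟩) ⟨T₀, t₀, t₁, le_rfl, by simp⟩ ?_).mono le_rfl ?_
      · rintro i hi s₅ e₅ r₅ a₅ ⟨T, h₁, h₂⟩
        have r₆ : ∀ x < 25, s₅.reg x = s.reg x := fun x hx => by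
          rw [r₅, r₄, r₃ x hx] <;> simp [Program.regs, growStep, forLoop] <;> omega
        have a₆ : ∀ a, a ≠ 2 → a ≠ 6 → s₅.arr a = s.arr a := fun a ha ha' => by
          rw [a₅, a₄, a₃ a ha ha'] <;> simp [Program.arrs, growStep, forLoop] <;> omega
        exact growStep_spec (hG.of_eq (r₆ 0 (by omega)) (r₆ 1 (by omega))
          (a₆ 0 (by omega) (by omega))) e₅ hi (by rwa [a₆ 13 (by omega) (by omega)]) h₁ h₂
      · rintro s₅ ⟨T, h₁, h₂⟩
        refine ⟨T, h₁, h₂.tree, fun A hAW hA v hv => ?_⟩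
        by_cases hvr : v = r
        · rw [hvr]; exact h₂.tree.arborescence.root_mem
        obtain ⟨hvA, u, hu, ha⟩ := hv.exists_pred hvr
        have hc : (A.erase v).card ≤ j := by rw [Finset.card_erase_of_mem hvA]; omega
        refine h₂.done u v ?_ (t₂ _ ((Finset.erase_subset _ _).trans hAW) hc u hu) ha (hAW hvA)
        have := u.2; have := v.2; nlinarith
    · rintro s₄ ⟨T, h₁, h₂, h₃⟩
      exact ⟨T, h₁, h₂, fun v => ⟨h₂.reach v, h₃ W le_rfl (card_le_of_fin _) v⟩⟩
  · have h₁ : 1 ≤ n ^ 3 := Nat.one_le_pow _ _ hn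
    have h₂ : n ≤ n ^ 3 := Nat.le_self_pow (by omega) n
    have h₃ : n ^ 2 ≤ n ^ 3 := Nat.pow_le_pow_right hn (by omega)
    calc _ = 5 * n ^ 3 + 3 * n ^ 2 + 7 * n + 7 := by ring
      _ ≤ _ := by omega

end RAM

/-! ### Greedy covering by short paths -/

section Greedy

variable {n : ℕ} {G : Digraph (Fin n)} {r : Fin n} {R : Finset (Fin n)} {a b : ℕ}

/-- The invariant of the greedy phase: `U` is the set of terminals that are still uncovered,
and `S` consists of the terminals and the vertices that have been bought. -/
structure GreedyInv (G : Digraph (Fin n)) (r : Fin n) (R : Finset (Fin n)) (a b j : ℕ)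
    (U S : Finset (Fin n)) : Prop where
  sub : U ⊆ R
  free : R ⊆ S
  reach : ∀ t ∈ R, t ∉ U → ReachIn G S r t
  -- For ε = a/b this reads |S| ≤ |R| + ε(|R| - 1 - |U|). The separate `a` records that the root,
  -- covered from the outset, pays nothing.
  cost : S.card * b + U.card * a + a ≤ R.card * (b + a)
  done : ∀ v : Fin n, v.1 < j → ∀ B, ReachIn G (R ∪ B) r v →
    ∀ C ⊆ U, (∀ t ∈ C, ReachIn G R v t) → C.card * a ≤ B.card * b

theorem GreedyInv.init (hr : r ∈ R) : GreedyInv G r R a b 0 (R.erase r) R where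
  sub := Finset.erase_subset _ _
  free := le_rfl
  reach t ht htU := by
    have : t = r := by by_contra h; exact htU (Finset.mem_erase.2 ⟨h, ht⟩)
    rw [this]; exact .refl _ _
  cost := by
    have h := Finset.card_erase_add_one hr
    rw [← h]; ring_nf; rfl
  done := by simp

/-- A purchase covers every terminal that `v` reaches through terminals, so the condition for `v`
becomes void. For earlier vertices it persists because `U` shrinks; hence one pass over the vertices
is enough. -/
theorem GreedyInv.buy {v : Fin n} {U S P D : Finset (Fin n)} (h : GreedyInv G r R a b v U S)
    (hP : IsSteinerMin G r R {v} P) (hD : ∀ u, u ∈ D ↔ ReachIn G (R ∪ P) r u)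
    (hc : P.card * b ≤ (U ∩ D).card * a) : GreedyInv G r R a b (v + 1) (U \ D) (S ∪ P) where
  sub := Finset.sdiff_subset.trans h.sub
  free := h.free.trans Finset.subset_union_left
  reach t ht htU := by
    by_cases htD : t ∈ D
    · exact ((hD t).1 htD).mono (Finset.union_subset_union_left h.free)
    · exact (h.reach t ht fun h' => htU (Finset.mem_sdiff.2 ⟨h', htD⟩)).mono
        Finset.subset_union_left
  cost := by
    have h₁ : (S ∪ P).card * b ≤ S.card * b + P.card * b := by
      rw [← add_mul]; exact Nat.mul_le_mul_right _ (Finset.card_union_le _ _)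
    have h₂ : (U \ D).card * a + (U ∩ D).card * a = U.card * a := by
      rw [← add_mul, Finset.card_sdiff_add_card_inter]
    have := h.cost
    omega
  done w hw B hB C hC hCR := by
    rcases Nat.lt_succ_iff_lt_or_eq.1 hw with hw | hw
    · exact h.done w hw B hB C (hC.trans Finset.sdiff_subset) hCR
    · obtain rfl : w = v := Fin.ext hw
      have hv := hP.reach (B := R ∪ B) (by simpa using hB) w (by simp)
      have : C = ∅ := by
        rw [Finset.eq_empty_iff_forall_notMem]
        intro t ht
        exact (Finset.mem_sdiff.1 (hC ht)).2 ((hD t).2 (hv.trans ((hCR t ht).mono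
          Finset.subset_union_left)))
      simp [this]

/-- By minimality of `P`, declining it bounds every other way to `v`: |C|a ≤ |U ∩ D|a < |P|b ≤ |B|b.
-/
theorem GreedyInv.pass {v : Fin n} {U S P D : Finset (Fin n)} (h : GreedyInv G r R a b v U S)
    (hP : IsSteinerMin G r R {v} P) (hD : ∀ u, u ∈ D ↔ ReachIn G (R ∪ P) r u)
    (hc : (U ∩ D).card * a < P.card * b) : GreedyInv G r R a b (v + 1) U S where
  sub := h.sub
  free := h.free
  reach := h.reach
  cost := h.cost
  done w hw B hB C hC hCR := by
    rcases Nat.lt_succ_iff_lt_or_eq.1 hw with hw | hw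
    · exact h.done w hw B hB C hC hCR
    · obtain rfl : w = v := Fin.ext hw
      have hv := hP.reach (B := R ∪ B) (by simpa using hB) w (by simp)
      have h₁ : C ⊆ U ∩ D := fun t ht => Finset.mem_inter.2 ⟨hC ht, (hD t).2 (hv.trans
        ((hCR t ht).mono Finset.subset_union_left))⟩
      have h₂ := Nat.mul_le_mul_right a (Finset.card_le_card h₁)
      have h₃ := Nat.mul_le_mul_right b (hP.card_le B (by simpa using hB))
      omega

/-- A solution with `N` vertices is good in comparison with all solutions on `R` and a connected
set of Steiner vertices `S` that is not too large. -/
def IsGoodSize (G : Digraph (Fin n)) (r : Fin n) (a b p : ℕ) (R : Finset (Fin n)) (N : ℕ) : Prop :=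
  ∀ S : Finset (Fin n), (∀ v ∈ R ∪ S, ReachIn G (R ∪ S) r v) → S.card * (S.card + 1) ≤ p * p →
    N * b + a ≤ R.card * (b + a) + S.card * b

/-- Read in the contrapositive, this justifies abandoning a guess: if `U` is too large, no
admissible competitor contains the guess. -/
theorem GreedyInv.card_le {U S S' : Finset (Fin n)} {p : ℕ} (h : GreedyInv G r R a b n U S)
    (hS : ∀ v ∈ R ∪ S', ReachIn G (R ∪ S') r v) (hp : S'.card * (S'.card + 1) ≤ p * p) :
    2 * U.card * a ≤ p * p * b := by
  have := two_mul_card_uncovered_le h.sub (fun v => h.done v v.2) hS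
  rw [mul_assoc]
  exact this.trans (Nat.mul_le_mul_right _ hp)

/-- A competitor also serves `U`, so the exact phase adds at most as many vertices as the competitor
has in S'; the remainder is the greedy charge. -/
theorem GreedyInv.isGoodSize {U S P : Finset (Fin n)} {p : ℕ} (h : GreedyInv G r R a b n U S)
    (hP : IsSteinerMin G r R U P) : IsGoodSize G r a b p R (S ∪ P).card := by
  intro S' hS' _
  have h₁ := hP.card_le S' fun t ht => hS' t (Finset.mem_union_left _ (h.sub ht))
  have h₂ : (S ∪ P).card * b ≤ S.card * b + P.card * b := by
    rw [← add_mul]; exact Nat.mul_le_mul_right _ (Finset.card_union_le _ _)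
  have h₃ := Nat.mul_le_mul_right b h₁
  have h₄ := h.cost
  have : U.card * a ≥ 0 := Nat.zero_le _
  omega

theorem GreedyInv.feasible {U S P : Finset (Fin n)} (h : GreedyInv G r R a b n U S)
    (hP : IsSteinerMin G r R U P) {t : Fin n} (ht : t ∈ R) (hr : ReachIn G Finset.univ r t) :
    ReachIn G (S ∪ P) r t := by
  rcases hP.valid with h' | h'
  · exact hr.mono fun u _ => by simp [h']
  · by_cases htU : t ∈ U
    · exact (h' t htU).mono (Finset.union_subset_union_left h.free)
    · exact (h.reach t ht htU).mono Finset.subset_union_left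

/-- The invariant of the main loop: `B` is the vertex set of the best solution so far. -/
structure MainInv (G : Digraph (Fin n)) (r : Fin n) (R : Finset (Fin n)) (a b p j : ℕ)
    (B : Finset (Fin n)) : Prop where
  sub : R ⊆ B
  feasible : ∀ t ∈ R, ReachIn G Finset.univ r t → ReachIn G B r t
  done : ∀ x : Fin n, x.1 < j → IsGoodSize G r a b p (insert x R) B.card

theorem IsGoodSize.mono {p N N' : ℕ} (h : IsGoodSize G r a b p R N) (hN : N' ≤ N) :
    IsGoodSize G r a b p R N' := fun S hS hp => by
  have := h S hS hp
  have := Nat.mul_le_mul_right b hN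
  omega

theorem MainInv.update {p : ℕ} {x : Fin n} {B W : Finset (Fin n)} (h : MainInv G r R a b p x B)
    (hR : R ⊆ W) (hW : ∀ t ∈ R, ReachIn G Finset.univ r t → ReachIn G W r t)
    (hg : IsGoodSize G r a b p (insert x R) W.card) (hlt : W.card < B.card) :
    MainInv G r R a b p (x + 1) W where
  sub := hR
  feasible := hW
  done y hy := by
    rcases Nat.lt_succ_iff_lt_or_eq.1 hy with hy | hy
    · exact (h.done y hy).mono hlt.le
    · rwa [Fin.ext hy]

theorem MainInv.keep {p : ℕ} {x : Fin n} {B : Finset (Fin n)} (h : MainInv G r R a b p x B)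
    (hg : IsGoodSize G r a b p (insert x R) B.card) : MainInv G r R a b p (x + 1) B where
  sub := h.sub
  feasible := h.feasible
  done y hy := by
    rcases Nat.lt_succ_iff_lt_or_eq.1 hy with hy | hy
    · exact h.done y hy
    · rwa [Fin.ext hy]

end Greedy

/-! ### The greedy phase on the machine -/

namespace RAM

variable {n : ℕ}

/-- Store the characteristic function of a set in the array `a`. -/
def setLoop (a : ℕ) (e : Term) : Program := mapLoop 25 0 a (.reg 25) e

theorem Triple.setLoop {M a : ℕ} {e : Term} {s : Store} (S : Finset (Fin n)) (h₀ : s.reg 0 = n)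
    (he : e.Small)
    (h : ∀ (u : Fin n) s', s'.reg 25 = (u : ℕ) → (∀ x, x ≠ 25 → s'.reg x = s.reg x) →
      (∀ a', a' ≠ a → s'.arr a' = s.arr a') → s'.arr a u = s.arr a u →
      e.eval s' = if u ∈ S then 1 else 0) :
    Triple M (setLoop a e) s (n * 3 + 2) (fun s' => IsIndicator (s'.arr a) S ∧
      (∀ x, x ≠ 25 → s'.reg x = s.reg x) ∧ ∀ a', a' ≠ a → s'.arr a' = s.arr a') := by
  refine (Triple.mapLoop 0 (fun j => if ∃ u ∈ S, u.1 = j then 1 else 0) (by decide) h₀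
    (by decide) he ?_).frame.mono le_rfl ?_
  · intro j hj s' h₁ h₂ h₃ h₄
    refine ⟨by simp [h₁], ?_, fun b => ?_⟩
    · rw [h ⟨j, hj⟩ s' h₁ h₂ h₃ (h₄ j fun j' hj' => by omega)]
      congr 1
      exact propext ⟨fun hS => ⟨_, hS, rfl⟩, fun ⟨u, hu, hj'⟩ => by
        rwa [show (⟨j, hj⟩ : Fin n) = u from Fin.ext hj'.symm]⟩
    · have := b.two_le
      split_ifs <;> omega
  · rintro s' ⟨f, q, -⟩
    refine ⟨fun u => ?_, fun x hx => f.reg x (by simpa [Program.regs, RAM.mapLoop, RAM.forLoop]),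
      fun a' ha' => f.arr a' (by simpa [Program.arrs, RAM.mapLoop, RAM.forLoop])⟩
    have := q u u.2
    rw [zero_add] at this
    rw [this]
    congr 1
    exact propext ⟨fun ⟨v, hv, h'⟩ => Fin.ext h' ▸ hv, fun hu => ⟨u, hu, rfl⟩⟩

/-- Store the size of a set in the register `x`. -/
def countLoop (x : ℕ) (e : Term) : Program := sumLoop 25 0 x e

theorem Triple.countLoop {M x : ℕ} {e : Term} {s : Store} (S : Finset (Fin n)) (h₀ : s.reg 0 = n)
    (hx : x ≠ 0) (hx' : x ≠ 25) (he : (Term.reg x + e).Small) (hM : n ≤ M)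
    (h : ∀ (u : Fin n) s', s'.reg 25 = (u : ℕ) → s'.arr = s.arr →
      e.eval s' = if u ∈ S then 1 else 0) :
    Triple M (countLoop x e) s (n * 3 + 3) (fun s' => s'.reg x = S.card ∧
      (∀ y, y ≠ 25 → y ≠ x → s'.reg y = s.reg y) ∧ s'.arr = s.arr) := by
  have hi : IsIndicator (fun j => if ∃ u ∈ S, u.1 = j then 1 else 0) S := by
    intro u
    dsimp only
    congr 1
    exact propext ⟨fun ⟨v, hv, h'⟩ => Fin.ext h' ▸ hv, fun hu => ⟨u, hu, rfl⟩⟩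
  refine (Triple.sumLoop (fun j => if ∃ u ∈ S, u.1 = j then 1 else 0) (by decide) hx.symm hx' h₀ he
    (fun _ => ?_) ?_).frame.mono le_rfl ?_
  · rw [hi.sum]; exact (card_le_of_fin S).trans hM
  · intro j hj s' h₁ _ h₃
    rw [h ⟨j, hj⟩ s' h₁ h₃]
    exact (hi ⟨j, hj⟩).symm
  · rintro s' ⟨f, q⟩
    refine ⟨by rw [q, hi.sum], fun y hy hy' => f.reg y ?_, funext fun a => f.arr a ?_⟩
    · simp [Program.regs, RAM.sumLoop, RAM.forLoop, hy, hy']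
    · simp [Program.arrs, RAM.sumLoop, RAM.forLoop]

/-- The store describes an instance. -/
structure HasInput (G : Digraph (Fin n)) (r : Fin n) (R : Finset (Fin n)) (a b p : ℕ)
    (s : Store) : Prop where
  graph : HasGraph G r s
  terminals : IsIndicator (s.arr 1) R
  bound : s.reg 2 = p
  num : s.reg 3 = a
  den : s.reg 4 = b

theorem HasInput.of_eq {G : Digraph (Fin n)} {r : Fin n} {R : Finset (Fin n)} {a b p : ℕ}
    {s s' : Store} (h : HasInput G r R a b p s) (hr : ∀ x < 5, s'.reg x = s.reg x)
    (ha : ∀ a < 2, s'.arr a = s.arr a) : HasInput G r R a b p s' where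
  graph := h.graph.of_eq (hr 0 (by omega)) (hr 1 (by omega)) (ha 0 (by omega))
  terminals := by rw [ha 1 (by omega)]; exact h.terminals
  bound := by rw [hr 2 (by omega), h.bound]
  num := by rw [hr 3 (by omega), h.num]
  den := by rw [hr 4 (by omega), h.den]

/-- Find a shortest path to the vertex in register `6`, and buy it if it covers enough terminals
that are still uncovered. -/
def greedyStep : Program :=
  .seq (setLoop 12 (Term.same (.reg 25) (.reg 6))) <|
  .seq steiner <|
  .seq (setLoop 13 (Term.less 0 (.cell 3 (.reg 25) + .cell 10 (.reg 25)))) <|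
  .seq grow <|
  .seq (countLoop 7 (.cell 7 (.reg 25) * .cell 6 (.reg 25))) <|
  .seq (countLoop 8 (.cell 10 (.reg 25))) <|
  .ite (Term.less (.reg 7 * .reg 3) (.reg 8 * .reg 4)) .skip <|
  .seq (setLoop 7 (.cell 7 (.reg 25) * (1 - .cell 6 (.reg 25))))
    (setLoop 8 (Term.less 0 (.cell 8 (.reg 25) + .cell 10 (.reg 25))))

theorem greedyStep_regs {x : ℕ} (hx : x < 12) (h7 : x ≠ 7) (h8 : x ≠ 8) :
    x ∉ greedyStep.regs := by
  have h₁ := steiner_regs hx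
  have h₂ := grow_regs (x := x) (by omega)
  simp [Program.regs, greedyStep, setLoop, countLoop, sumLoop, mapLoop, forLoop, h₁, h₂]
  omega

theorem greedyStep_arrs {x : ℕ} (hx : x ≠ 2) (hx' : x < 4 ∨ x = 9) : x ∉ greedyStep.arrs := by
  have h₁ := steiner_arrs (a := x) (by omega) (by omega) (by omega) (by omega)
  have h₂ := grow_arrs (a := x) hx (by omega)
  simp [Program.arrs, greedyStep, setLoop, countLoop, sumLoop, mapLoop, forLoop, h₁, h₂]
  omega

theorem greedyStep_spec {M : ℕ} {s : Store} {G : Digraph (Fin n)} {r v : Fin n}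
    {R R₀ U S : Finset (Fin n)} {a b p : ℕ} (hI : HasInput G r R₀ a b p s)
    (hR : IsIndicator (s.arr 3) R) (hU : IsIndicator (s.arr 7) U) (hS : IsIndicator (s.arr 8) S)
    (hv : s.reg 6 = v) (h : GreedyInv G r R a b v U S) (hM : n * n * (2 ^ n * 2 ^ n) ≤ M) :
    Triple M greedyStep s (400 * n ^ 4) (fun s' => ∃ U' S', IsIndicator (s'.arr 7) U' ∧
      IsIndicator (s'.arr 8) S' ∧ GreedyInv G r R a b (v + 1) U' S') := by
  have hn : 1 ≤ n := r.pos
  have h22 : 1 ≤ 2 ^ n * 2 ^ n := Nat.mul_pos (by positivity) (by positivity)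
  have hM₂ : n * n ≤ M := (Nat.le_mul_of_pos_right _ h22).trans hM
  have hM₁ : n ≤ M := (Nat.le_mul_of_pos_right _ hn).trans hM₂
  -- A shortest path is a Steiner problem with a single target, so only two masks occur and the call
  -- is polynomial.
  refine Triple.mono (k := (n * 3 + 2) + (80 * n ^ 4 * (2 ^ ({v} : Finset (Fin n)).card) ^ 2 +
    ((n * 3 + 2) + (30 * n ^ 3 + ((n * 3 + 3) + ((n * 3 + 3) +
      (((n * 3 + 2) + (n * 3 + 2)) + 1))))))) ?_ ?_ (fun _ h => h)
  · refine Triple.seq (Triple.setLoop {v} hI.graph.size (by decide) ?_) ?_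
    · intro u s' h₁ h₂ h₃ _
      simp [h₁, h₂, hv, Fin.ext_iff]
    rintro s₁ - ⟨q₁, r₁, a₁⟩
    refine Triple.seq (steiner_spec (R := R) (hI.graph.of_eq (r₁ 0 (by omega)) (r₁ 1 (by omega))
      (a₁ 0 (by omega))) (by rwa [a₁ 3 (by omega)]) q₁ hM) ?_
    rintro s₂ f₂ ⟨P, q₂, hP⟩
    have r₂ : ∀ x < 12, s₂.reg x = s.reg x := fun x hx => by
      rw [f₂.reg x (steiner_regs hx), r₁ x (by omega)]
    have a₂ : ∀ a, a ≠ 4 → a ≠ 5 → a ≠ 10 → a ≠ 11 → a ≠ 12 → s₂.arr a = s.arr a :=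
      fun a h₄ h₅ h₁₀ h₁₁ h₁₂ => by rw [f₂.arr a (steiner_arrs h₄ h₅ h₁₀ h₁₁), a₁ a h₁₂]
    clear f₂
    refine Triple.seq (Triple.setLoop (R ∪ P) ((r₂ 0 (by omega)).trans hI.graph.size)
      (by decide) ?_) ?_
    · intro u s' h₁ h₂ h₃ _
      have e₁ := hR u
      rw [← a₂ 3 (by omega) (by omega) (by omega) (by omega) (by omega)] at e₁
      have e₂ := q₂ u
      by_cases c₁ : u ∈ R <;> by_cases c₂ : u ∈ P <;> simp [c₁, c₂] at e₁ e₂ <;>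
        simp [h₁, h₃, e₁, e₂, c₁, c₂]
    rintro s₃ - ⟨q₃, r₃, a₃⟩
    refine Triple.seq (grow_spec (hI.graph.of_eq (by rw [r₃ 0 (by omega), r₂ 0 (by omega)])
      (by rw [r₃ 1 (by omega), r₂ 1 (by omega)]) (by rw [a₃ 0 (by omega), a₂] <;> omega)) q₃
      hM₂) ?_
    -- Only the vertex set of this tree matters: it is the set reached from the root through the
    -- terminals and `P`.
    rintro s₄ f₄ ⟨T, ht, -, hD⟩
    have q₄ := ht.verts
    have r₄ : ∀ x < 12, s₄.reg x = s.reg x := fun x hx => by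
      rw [f₄.reg x (grow_regs (by omega)), r₃ x (by omega), r₂ x hx]
    have a₄ : ∀ a, a ≠ 2 → a ≠ 6 → a ≠ 13 → s₄.arr a = s₂.arr a :=
      fun a h₁ h₂ h₃ => by rw [f₄.arr a (grow_arrs h₁ h₂), a₃ a h₃]
    have u₄ : IsIndicator (s₄.arr 7) U := by
      rw [a₄ 7 (by omega) (by omega) (by omega), a₂ 7] <;> first | exact hU | omega
    have S₄ : IsIndicator (s₄.arr 8) S := by
      rw [a₄ 8 (by omega) (by omega) (by omega), a₂ 8] <;> first | exact hS | omega
    have p₄ : IsIndicator (s₄.arr 10) P := by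
      rw [a₄ 10 (by omega) (by omega) (by omega)]; exact q₂
    refine Triple.seq (Triple.countLoop (U ∩ T.verts) ((r₄ 0 (by omega)).trans hI.graph.size)
      (by decide) (by decide) (by decide) hM₁ ?_) ?_
    · intro u s' h₁ h₂
      have e₁ := u₄ u
      have e₂ := q₄ u
      by_cases c₁ : u ∈ U <;> by_cases c₂ : u ∈ T.verts <;> simp [c₁, c₂] at e₁ e₂ <;>
        simp [h₁, h₂, e₁, e₂, c₁, c₂]
    rintro s₅ - ⟨q₅, r₅, a₅⟩
    refine Triple.seq (Triple.countLoop P (by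
        rw [r₅ 0 (by omega) (by omega), r₄ 0 (by omega), hI.graph.size])
      (by decide) (by decide) (by decide) hM₁ ?_) ?_
    · intro u s' h₁ h₂
      simpa [h₁, h₂, a₅] using p₄ u
    rintro s₆ - ⟨q₆, r₆, a₆⟩
    rw [a₅] at a₆
    have e₇ : s₆.reg 7 = (U ∩ T.verts).card := by rw [r₆ 7 (by omega) (by omega), q₅]
    have e₃ : s₆.reg 3 = a := by
      rw [r₆ 3 (by omega) (by omega), r₅ 3 (by omega) (by omega), r₄ 3 (by omega), hI.num]
    have e₄ : s₆.reg 4 = b := by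
      rw [r₆ 4 (by omega) (by omega), r₅ 4 (by omega) (by omega), r₄ 4 (by omega), hI.den]
    have e₀ : s₆.reg 0 = n := by
      rw [r₆ 0 (by omega) (by omega), r₅ 0 (by omega) (by omega), r₄ 0 (by omega), hI.graph.size]
    refine Triple.ite (by decide) (fun hc => ?_) (fun hc => ?_)
    · have hc' : (U ∩ T.verts).card * a < P.card * b := by
        by_contra hlt; simp [e₇, e₃, e₄, q₆, hlt] at hc
      exact (Triple.skip ⟨U, S, by rwa [a₆], by rwa [a₆], h.pass hP hD hc'⟩).mono (by omega)
        (fun _ h => h)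
    · have hc' : P.card * b ≤ (U ∩ T.verts).card * a := by
        by_contra hlt; simp [e₇, e₃, e₄, q₆] at hc; omega
      refine Triple.seq (Triple.setLoop (U \ T.verts) e₀ (by decide) ?_) ?_
      · intro u s' h₁ h₂ h₃ h₄
        have e₁ := u₄ u
        have e₂ := q₄ u
        rw [a₆] at h₃ h₄
        by_cases c₁ : u ∈ U <;> by_cases c₂ : u ∈ T.verts <;> simp [c₁, c₂] at e₁ e₂ <;>
          simp [h₁, h₃, h₄, e₁, e₂, c₁, c₂]
      rintro s₇ - ⟨q₇, r₇, a₇⟩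
      refine (Triple.setLoop (S ∪ P) ((r₇ 0 (by omega)).trans e₀) (by decide) ?_).mono le_rfl ?_
      · intro u s' h₁ h₂ h₃ h₄
        have e₁ := S₄ u
        have e₂ := p₄ u
        rw [a₇ 8 (by omega), a₆] at h₄
        have h₁₀ := (h₃ 10 (by omega)).trans (a₇ 10 (by omega))
        rw [a₆] at h₁₀
        by_cases c₁ : u ∈ S <;> by_cases c₂ : u ∈ P <;> simp [c₁, c₂] at e₁ e₂ <;>
          simp [h₁, h₄, h₁₀, e₁, e₂, c₁, c₂]
      · rintro s₈ ⟨q₈, -, a₈⟩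
        exact ⟨_, _, by rwa [a₈ 7 (by omega)], q₈, h.buy hP hD hc'⟩
  · have h₁ : 1 ≤ n ^ 4 := Nat.one_le_pow _ _ hn
    have h₂ : n ≤ n ^ 4 := Nat.le_self_pow (by omega) n
    have h₃ : n ^ 3 ≤ n ^ 4 := Nat.pow_le_pow_right hn (by omega)
    rw [Finset.card_singleton]
    omega

end RAM

/-! ### Guessing one Steiner vertex, and the main loop -/

namespace RAM

variable {n : ℕ}

/-- Compute a solution that contains the vertex in register `5`, and keep it if it is better than
the best solution so far. -/
def guessStep : Program :=
  .seq (setLoop 3 (Term.less 0 (.cell 1 (.reg 25) + Term.same (.reg 25) (.reg 5)))) <|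
  .seq (setLoop 8 (.cell 3 (.reg 25))) <|
  .seq (setLoop 7 (.cell 3 (.reg 25) * (1 - Term.same (.reg 25) (.reg 1)))) <|
  .seq (forLoop 6 0 greedyStep) <|
  .seq (countLoop 9 (.cell 7 (.reg 25))) <|
  .ite (Term.less (.reg 2 * .reg 2 * .reg 4) (2 * .reg 9 * .reg 3)) .skip <|
  .seq (setLoop 12 (.cell 7 (.reg 25))) <|
  .seq steiner <|
  .seq (setLoop 8 (Term.less 0 (.cell 8 (.reg 25) + .cell 10 (.reg 25)))) <|
  .seq (countLoop 10 (.cell 8 (.reg 25))) <|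
  .ite (Term.less (.reg 10) (.reg 11))
    (.seq (.assign 11 (.reg 10)) (setLoop 9 (.cell 8 (.reg 25)))) .skip

theorem guessStep_regs {x : ℕ} (hx : x < 6) : x ∉ guessStep.regs := by
  have h₁ := steiner_regs (x := x) (by omega)
  have h₂ := greedyStep_regs (x := x) (by omega) (by omega) (by omega)
  simp [Program.regs, guessStep, setLoop, countLoop, sumLoop, mapLoop, forLoop, h₁, h₂]
  omega

theorem guessStep_arrs {x : ℕ} (hx : x < 2) : x ∉ guessStep.arrs := by
  have h₁ := steiner_arrs (a := x) (by omega) (by omega) (by omega) (by omega)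
  have h₂ := greedyStep_arrs (x := x) (by omega) (by omega)
  simp [Program.arrs, guessStep, setLoop, countLoop, sumLoop, mapLoop, forLoop, h₁, h₂]
  omega

theorem greedyLoop_spec {M : ℕ} {s : Store} {G : Digraph (Fin n)} {r : Fin n}
    {R R₀ : Finset (Fin n)} {a b p : ℕ} (hI : HasInput G r R₀ a b p s)
    (hR : IsIndicator (s.arr 3) R) (hU : IsIndicator (s.arr 7) (R.erase r))
    (hS : IsIndicator (s.arr 8) R) (hr : r ∈ R) (hM : n * n * (2 ^ n * 2 ^ n) ≤ M) :
    Triple M (forLoop 6 0 greedyStep) s (n * (400 * n ^ 4 + 2) + 2) (fun s' => ∃ U S,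
      IsIndicator (s'.arr 7) U ∧ IsIndicator (s'.arr 8) S ∧ GreedyInv G r R a b n U S) := by
  refine Triple.forLoop (k := 400 * n ^ 4) (fun j s' => ∃ U S, IsIndicator (s'.arr 7) U ∧
    IsIndicator (s'.arr 8) S ∧ GreedyInv G r R a b j U S)
    (greedyStep_regs (by omega) (by omega) (by omega))
    (greedyStep_regs (by omega) (by omega) (by omega)) (by decide) hI.graph.size
    (fun _ _ _ h => h) ⟨_, _, hU, hS, GreedyInv.init hr⟩ ?_
  rintro j hj s' e r₁ a₁ ⟨U, S, hU, hS, h⟩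
  exact greedyStep_spec (v := ⟨j, hj⟩) (hI.of_eq
    (fun x hx => r₁ x (by omega) (greedyStep_regs (by omega) (by omega) (by omega)))
    (fun x hx => a₁ x (greedyStep_arrs (by omega) (by omega))))
    (by rwa [a₁ 3 (greedyStep_arrs (by omega) (by omega))]) hU hS e h hM

/-- The number `E` has to dominate 4^|U| only for those `U` that pass the size test, since the exact
subroutine is not called otherwise. -/
theorem guessStep_spec {M E : ℕ} {s : Store} {G : Digraph (Fin n)} {r x : Fin n}
    {R B : Finset (Fin n)} {a b p : ℕ} (hr : r ∈ R) (hI : HasInput G r R a b p s)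
    (hx : s.reg 5 = x) (hB : IsIndicator (s.arr 9) B) (hc : s.reg 11 = B.card)
    (h : MainInv G r R a b p x B) (hM : n * n * (2 ^ n * 2 ^ n) ≤ M)
    (hE : ∀ k, 2 * k * a ≤ p * p * b → (2 ^ k) ^ 2 ≤ E) :
    Triple M guessStep s (600 * n ^ 5 * E) (fun s' => ∃ B', IsIndicator (s'.arr 9) B' ∧
      s'.reg 11 = B'.card ∧ MainInv G r R a b p (x + 1) B') := by
  have hn : 1 ≤ n := r.pos
  have h22 : 1 ≤ 2 ^ n * 2 ^ n := Nat.mul_pos (by positivity) (by positivity)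
  have hM₂ : n * n ≤ M := (Nat.le_mul_of_pos_right _ h22).trans hM
  have hM₁ : n ≤ M := (Nat.le_mul_of_pos_right _ hn).trans hM₂
  have hE1 : 1 ≤ E := by simpa using hE 0 (by simp)
  refine Triple.mono (k := (n * 3 + 2) + ((n * 3 + 2) + ((n * 3 + 2) +
    ((n * (400 * n ^ 4 + 2) + 2) + ((n * 3 + 3) + (((n * 3 + 2) + (80 * n ^ 4 * E +
      ((n * 3 + 2) + ((n * 3 + 3) + ((1 + (n * 3 + 2)) + 1))))) + 1)))))) ?_ ?_ (fun _ h => h)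
  · refine Triple.seq (Triple.setLoop (insert x R) hI.graph.size (by decide) ?_) ?_
    · intro u s' h₁ h₂ h₃ _
      have e₁ := hI.terminals u
      by_cases c₁ : u = x <;> by_cases c₂ : u ∈ R <;> simp [c₂] at e₁ <;>
        simp [h₁, h₂, h₃, hx, e₁, ← Fin.ext_iff, c₁, c₂]
    rintro s₁ - ⟨q₁, r₁, a₁⟩
    have e₁ : s₁.reg 0 = n := by rw [r₁ 0 (by omega), hI.graph.size]
    refine Triple.seq (Triple.setLoop (insert x R) e₁ (by decide) ?_) ?_
    · intro u s' h₁ h₂ h₃ _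
      simpa [h₁, h₃] using q₁ u
    rintro s₂ - ⟨q₂, r₂, a₂⟩
    have e₂ : s₂.reg 0 = n := by rw [r₂ 0 (by omega), e₁]
    refine Triple.seq (Triple.setLoop ((insert x R).erase r) e₂ (by decide) ?_) ?_
    · intro u s' h₁ h₂ h₃ _
      have g₁ := q₁ u
      have g₂ : s'.reg 1 = r := by
        rw [h₂ 1 (by omega), r₂ 1 (by omega), r₁ 1 (by omega), hI.graph.root]
      rw [← a₂ 3 (by omega)] at g₁
      rw [Term.eval_mul, Term.eval_sub, Term.eval_same, Term.eval_cell, Term.eval_reg,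
        Term.eval_reg, Term.eval_one, h₁, g₂, h₃ 3 (by omega), g₁]
      by_cases c₁ : u = r <;> by_cases c₂ : u ∈ insert x R <;>
        simp [← Fin.ext_iff, c₁]
    rintro s₃ - ⟨q₃, r₃, a₃⟩
    have rr₃ : ∀ y, y ≠ 25 → s₃.reg y = s.reg y := fun y hy => by rw [r₃ y hy, r₂ y hy, r₁ y hy]
    have aa₃ : ∀ y, y ≠ 3 → y ≠ 7 → y ≠ 8 → s₃.arr y = s.arr y := fun y h₁ h₂ h₃ => by
      rw [a₃ y h₂, a₂ y h₃, a₁ y h₁]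
    have i₃ : HasInput G r R a b p s₃ := hI.of_eq (fun y hy => rr₃ y (by omega))
      (fun y hy => aa₃ y (by omega) (by omega) (by omega))
    have R₃ : IsIndicator (s₃.arr 3) (insert x R) := by
      rwa [a₃ 3 (by omega), a₂ 3 (by omega)]
    refine Triple.seq (greedyLoop_spec i₃ R₃ q₃ (by rwa [a₃ 8 (by omega)]) (by simp [hr]) hM) ?_
    rintro s₄ f₄ ⟨U, S, qU, qS, hG⟩
    have r₄ : ∀ y, y < 12 → y ≠ 6 → y ≠ 7 → y ≠ 8 → s₄.reg y = s.reg y :=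
      fun y hy h₁ h₂ h₃ => by
        rw [f₄.reg y, rr₃ y (by omega)]
        simpa [Program.regs, forLoop, h₁] using greedyStep_regs hy h₂ h₃
    have a₄ : ∀ y, y ≠ 2 → (y < 4 ∨ y = 9) → s₄.arr y = s₃.arr y := fun y h₁ h₂ => by
      rw [f₄.arr y]
      simpa [Program.arrs, forLoop] using greedyStep_arrs h₁ h₂
    have i₄ : HasInput G r R a b p s₄ := hI.of_eq
      (fun y hy => r₄ y (by omega) (by omega) (by omega) (by omega))
      (fun y hy => by rw [a₄ y (by omega) (by omega), aa₃ y (by omega) (by omega) (by omega)])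
    have R₄ : IsIndicator (s₄.arr 3) (insert x R) := by rwa [a₄ 3 (by omega) (by omega)]
    have B₄ : IsIndicator (s₄.arr 9) B := by
      rwa [a₄ 9 (by omega) (by omega), aa₃ 9 (by omega) (by omega) (by omega)]
    have c₄ : s₄.reg 11 = B.card := by
      rw [r₄ 11 (by omega) (by omega) (by omega) (by omega), hc]
    refine Triple.seq (Triple.countLoop U i₄.graph.size (by decide) (by decide) (by decide)
      hM₁ ?_) ?_
    · intro u s' h₁ h₂
      simpa [h₁, h₂] using qU u
    rintro s₅ - ⟨q₅, r₅, a₅⟩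
    have i₅ : HasInput G r R a b p s₅ := i₄.of_eq
      (fun y hy => r₅ y (by omega) (by omega)) (fun y hy => by rw [a₅])
    have c₅ : s₅.reg 11 = B.card := by rw [r₅ 11 (by omega) (by omega), c₄]
    refine Triple.ite (by decide) (fun hk => ?_) (fun hk => ?_)
    · have hk' : p * p * b < 2 * U.card * a := by
        by_contra hlt; simp [i₅.bound, i₅.num, i₅.den, q₅, hlt] at hk
      -- For an abandoned guess the claim is vacuous: no set S' is both connected and small enough.
      exact (Triple.skip ⟨B, by rwa [a₅], c₅, h.keep fun S' hS' hp =>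
        absurd (hG.card_le hS' hp) (by omega)⟩).mono (by omega) (fun _ h => h)
    have hk' : 2 * U.card * a ≤ p * p * b := by
      by_contra hlt; simp [i₅.bound, i₅.num, i₅.den, q₅] at hk; omega
    refine Triple.seq (Triple.setLoop U i₅.graph.size (by decide) ?_) ?_
    · intro u s' h₁ _ h₃ _
      simpa [h₁, h₃, a₅] using qU u
    rintro s₆ - ⟨q₆, r₆, a₆⟩
    rw [a₅] at a₆
    refine Triple.seq ((steiner_spec (R := insert x R) (i₅.graph.of_eq (r₆ 0 (by omega))
      (r₆ 1 (by omega)) (by rw [a₆ 0 (by omega), a₅])) (by rwa [a₆ 3 (by omega)]) q₆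
      hM).mono (Nat.mul_le_mul_left _ (hE _ hk')) (fun _ h => h)) ?_
    rintro s₇ f₇ ⟨P, q₇, hP⟩
    have S₇ : IsIndicator (s₇.arr 8) S := by
      rw [f₇.arr 8 (steiner_arrs (by omega) (by omega) (by omega) (by omega)), a₆ 8 (by omega)]
      exact qS
    have B₇ : IsIndicator (s₇.arr 9) B := by
      rw [f₇.arr 9 (steiner_arrs (by omega) (by omega) (by omega) (by omega)), a₆ 9 (by omega)]
      exact B₄
    have c₇ : s₇.reg 11 = B.card := by
      rw [f₇.reg 11 (steiner_regs (by omega)), r₆ 11 (by omega), c₅]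
    have e₇ : s₇.reg 0 = n := by
      rw [f₇.reg 0 (steiner_regs (by omega)), r₆ 0 (by omega), i₅.graph.size]
    refine Triple.seq (Triple.setLoop (S ∪ P) e₇ (by decide) ?_) ?_
    · intro u s' h₁ h₂ h₃ h₄
      have g₁ := S₇ u
      have g₂ := q₇ u
      by_cases c₁ : u ∈ S <;> by_cases c₂ : u ∈ P <;> simp [c₁, c₂] at g₁ g₂ <;>
        simp [h₁, h₃, h₄, g₁, g₂, c₁, c₂]
    rintro s₈ - ⟨q₈, r₈, a₈⟩
    refine Triple.seq (Triple.countLoop (S ∪ P) ((r₈ 0 (by omega)).trans e₇) (by decide)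
      (by decide) (by decide) hM₁ ?_) ?_
    · intro u s' h₁ h₂
      simpa [h₁, h₂] using q₈ u
    rintro s₉ - ⟨q₉, r₉, a₉⟩
    have c₉ : s₉.reg 11 = B.card := by rw [r₉ 11 (by omega) (by omega), r₈ 11 (by omega), c₇]
    have e₉ : s₉.reg 0 = n := by rw [r₉ 0 (by omega) (by omega), r₈ 0 (by omega), e₇]
    have hgood := hG.isGoodSize (p := p) hP
    refine Triple.ite (by decide) (fun hlt => ?_) (fun hlt => ?_)
    · have hlt' : (S ∪ P).card < B.card := by
        by_contra h'; simp [q₉, c₉, h'] at hlt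
      refine Triple.seq (Q' := fun s' => s' = s₉.setReg 11 (S ∪ P).card)
        (Triple.assign (by decide) (fun b => b.reg 10) (by simp [q₉])) ?_
      rintro _ - rfl
      refine (Triple.setLoop (S ∪ P) (by simpa using e₉) (by decide) ?_).mono le_rfl ?_
      · intro u s' h₁ h₂ h₃ h₄
        simpa [h₁, h₃, a₉] using q₈ u
      · rintro s' ⟨q, hreg, -⟩
        refine ⟨S ∪ P, q, by simp [hreg], h.update ?_ ?_ hgood hlt'⟩
        · exact (Finset.subset_insert x R).trans (hG.free.trans Finset.subset_union_left)
        · exact fun t ht => hG.feasible hP (Finset.mem_insert_of_mem ht)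
    · have hlt' : B.card ≤ (S ∪ P).card := by
        by_contra h'; simp [q₉, c₉] at hlt; omega
      exact (Triple.skip ⟨B, by rwa [a₉, a₈ 9 (by omega)], c₉,
        h.keep (hgood.mono hlt')⟩).mono (by omega) (fun _ h => h)
  · have h₁ : 1 ≤ n ^ 5 * E := Nat.mul_pos (by positivity) (by omega)
    have h₂ : n ≤ n ^ 5 * E :=
      (Nat.le_self_pow (by omega) n).trans (Nat.le_mul_of_pos_right _ (by omega))
    have h₃ : n ^ 4 * E ≤ n ^ 5 * E :=
      Nat.mul_le_mul_right _ (Nat.pow_le_pow_right hn (by omega))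
    have h₄ : n ^ 5 ≤ n ^ 5 * E := Nat.le_mul_of_pos_right _ (by omega)
    calc _ = 400 * n ^ 5 + 80 * (n ^ 4 * E) + 26 * n + 23 := by ring
      _ ≤ 600 * (n ^ 5 * E) := by omega
      _ = _ := by ring

/-- The whole algorithm. -/
def solver : Program :=
  .seq (.assign 11 (.reg 0)) <|
  .seq (setLoop 9 1) <|
  .seq (forLoop 5 0 guessStep) <|
  .seq (setLoop 13 (.cell 9 (.reg 25))) grow

theorem solver_spec {M E : ℕ} {s : Store} {G : Digraph (Fin n)} {r : Fin n}
    {R : Finset (Fin n)} {a b p : ℕ} (hr : r ∈ R) (hI : HasInput G r R a b p s)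
    (hM : n * n * (2 ^ n * 2 ^ n) ≤ M) (hE : ∀ k, 2 * k * a ≤ p * p * b → (2 ^ k) ^ 2 ≤ E) :
    Triple M solver s (700 * n ^ 6 * E) (fun s' => ∃ T B, OutputIs s' T ∧ IsTreeIn G B r T ∧
      (∀ v, v ∈ T.verts ↔ ReachIn G B r v) ∧ MainInv G r R a b p n B) := by
  have hn : 1 ≤ n := r.pos
  have h22 : 1 ≤ 2 ^ n * 2 ^ n := Nat.mul_pos (by positivity) (by positivity)
  have hM₂ : n * n ≤ M := (Nat.le_mul_of_pos_right _ h22).trans hM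
  have hE1 : 1 ≤ E := by simpa using hE 0 (by simp)
  refine Triple.mono (k := 1 + ((n * 3 + 2) + ((n * (600 * n ^ 5 * E + 2) + 2) +
    ((n * 3 + 2) + 30 * n ^ 3)))) ?_ ?_ (fun _ h => h)
  · refine Triple.seq (Q' := fun s' => s' = s.setReg 11 n) (Triple.assign (by decide)
      (fun b => b.reg 0) (by simp [hI.graph.size])) ?_
    rintro _ - rfl
    refine Triple.seq (Triple.setLoop (Finset.univ : Finset (Fin n)) (by simp [hI.graph.size])
      (by decide) (by simp)) ?_
    rintro s₂ - ⟨q₂, r₂, a₂⟩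
    have i₂ : HasInput G r R a b p s₂ := hI.of_eq
      (fun y hy => by rw [r₂ y (by omega), Store.setReg_reg, if_neg (by omega)])
      (fun y hy => by rw [a₂ y (by omega)]; rfl)
    refine Triple.seq (Triple.forLoop (k := 600 * n ^ 5 * E) (fun j s' => ∃ B,
      IsIndicator (s'.arr 9) B ∧ s'.reg 11 = B.card ∧ MainInv G r R a b p j B)
      (guessStep_regs (by omega)) (guessStep_regs (by omega)) (by decide) i₂.graph.size
      (fun _ _ _ h => by simpa using h) ⟨Finset.univ, q₂, by simp [r₂], ?_⟩ ?_) ?_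
    -- The search starts from the whole vertex set, which is feasible whenever anything is.
    · exact ⟨Finset.subset_univ _, fun _ _ h => h, by simp⟩
    · rintro j hj s₃ e₃ r₃ a₃ ⟨B, g₁, g₂, g₃⟩
      exact guessStep_spec (x := ⟨j, hj⟩) hr (i₂.of_eq
        (fun y hy => r₃ y (by omega) (guessStep_regs (by omega)))
        (fun y hy => a₃ y (guessStep_arrs (by omega)))) e₃ g₁ g₂ g₃ hM hE
    rintro s₃ f₃ ⟨B, g₁, g₂, g₃⟩
    have i₃ : HasInput G r R a b p s₃ := i₂.of_eq
      (fun y hy => f₃.reg y (by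
        have := guessStep_regs (x := y) (by omega)
        simp [Program.regs, forLoop, this]; omega))
      (fun y hy => f₃.arr y (by
        have := guessStep_arrs (x := y) (by omega)
        simp [Program.arrs, forLoop, this]))
    refine Triple.seq (Triple.setLoop B i₃.graph.size (by decide) ?_) ?_
    · intro u s' h₁ _ h₃ _
      simpa [h₁, h₃] using g₁ u
    rintro s₄ - ⟨q₄, r₄, a₄⟩
    refine (grow_spec (i₃.graph.of_eq (r₄ 0 (by omega)) (r₄ 1 (by omega)) (a₄ 0 (by omega))) q₄
      hM₂).mono le_rfl ?_
    rintro s₅ ⟨T, h₁, h₂, h₃⟩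
    exact ⟨T, B, h₁.arcs, h₂, h₃, g₃⟩
  · have h₁ : 1 ≤ n ^ 6 * E := Nat.mul_pos (by positivity) (by omega)
    have h₂ : n ≤ n ^ 6 * E :=
      (Nat.le_self_pow (by omega) n).trans (Nat.le_mul_of_pos_right _ (by omega))
    have h₃ : n ^ 3 ≤ n ^ 6 * E :=
      (Nat.pow_le_pow_right hn (by omega)).trans (Nat.le_mul_of_pos_right _ (by omega))
    calc _ = 600 * (n ^ 6 * E) + 30 * n ^ 3 + 8 * n + 7 := by ring
      _ ≤ 700 * (n ^ 6 * E) := by omega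
      _ = _ := by ring

end RAM

/-! ### Comparison with Steiner arborescences, and the time bounds -/

section Comparison

variable {n : ℕ} {G : Digraph (Fin n)} {r : Fin n} {R : Finset (Fin n)}

theorem ArcGraph.IsSteinerArborescence.reachIn {T : ArcGraph (Fin n)}
    (h : T.IsSteinerArborescence G R r) : ∀ v ∈ T.verts, ReachIn G T.verts r v := fun v hv =>
  Relation.ReflTransGen.mono (r := fun a b => (a, b) ∈ T.arcs)
    (fun _ _ hab => ⟨(h.subgraph _ hab).2.2, (h.subgraph _ hab).2.1⟩) _ _
    (h.arborescence.reachable v hv)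

/-- Every vertex other than the root is the head of some arc. -/
theorem ArcGraph.IsArborescence.card_verts_le {T : ArcGraph (Fin n)} (h : T.IsArborescence r) :
    T.verts.card ≤ T.cost + 1 := by
  have h₁ : T.verts.erase r ⊆ T.arcs.image Prod.snd := fun v hv => by
    obtain ⟨hvr, hv⟩ := Finset.mem_erase.1 hv
    obtain ⟨u, hu, -⟩ := h.inDegree v hv hvr
    exact Finset.mem_image.2 ⟨_, hu, rfl⟩
  have h₂ := (Finset.card_le_card h₁).trans Finset.card_image_le
  rw [Finset.card_erase_of_mem h.root_mem] at h₂
  simp only [ArcGraph.cost]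
  omega

/-- Choose as guess a Steiner vertex of `T`; the other q ≤ p - 1 then satisfy q(q+1) ≤ p². If there
is none, the guess `r` changes nothing and q = 0. -/
theorem MainInv.card_le {a b p : ℕ} {B : Finset (Fin n)} (h : MainInv G r R a b p n B)
    (hr : r ∈ R) {T : ArcGraph (Fin n)} (hT : T.IsSteinerArborescence G R r)
    (hp : T.steinerCount R ≤ p) : B.card * b + a ≤ T.verts.card * (b + a) := by
  obtain ⟨x, hx, hs⟩ : ∃ x ∈ T.verts, (T.verts \ insert x R).card *
      ((T.verts \ insert x R).card + 1) ≤ p * p := by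
    by_cases hne : (T.verts \ R).Nonempty
    · obtain ⟨x, hx⟩ := hne
      refine ⟨x, (Finset.mem_sdiff.1 hx).1, ?_⟩
      have h₁ : (T.verts \ insert x R).card + 1 ≤ p := by
        refine le_trans ?_ hp
        rw [Finset.sdiff_insert, Finset.card_erase_add_one hx]
        rfl
      exact Nat.mul_le_mul (by omega) h₁
    · refine ⟨r, hT.terminals hr, ?_⟩
      rw [Finset.not_nonempty_iff_eq_empty] at hne
      rw [Finset.insert_eq_of_mem hr, hne]
      simp
  have hsub : insert x R ⊆ T.verts := Finset.insert_subset hx hT.terminals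
  have hunion : insert x R ∪ T.verts \ insert x R = T.verts := Finset.union_sdiff_of_subset hsub
  have h₁ := h.done x x.2 (T.verts \ insert x R) (by rw [hunion]; exact hT.reachIn) hs
  have h₂ := Finset.card_sdiff_add_card_eq_card hsub
  rw [← h₂]
  nlinarith [Nat.zero_le ((T.verts \ insert x R).card * a)]

end Comparison

theorem RAM.size_le_of_le_two_pow {m k : ℕ} (h : m ≤ 2 ^ k) : m.size ≤ k + 1 :=
  Nat.size_le.2 (h.trans_lt (Nat.pow_lt_pow_right (by omega) (by omega)))

theorem inputStore_bdd {n : ℕ} (G : Digraph (Fin n)) (R : Finset (Fin n)) (r : Fin n)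
    (p : ℕ) (ε : ℚ) : (inputStore G R r p ε).Bdd (2 ^ (4 * inputLength n p ε)) := by
  have hn : 1 ≤ n := r.pos
  have key : ∀ x k : ℕ, x < 2 ^ k → k ≤ inputLength n p ε → x ≤ 2 ^ (4 * inputLength n p ε) :=
    fun x k h₁ h₂ => h₁.le.trans (Nat.pow_le_pow_right (by omega) (by omega))
  have h1 : 1 ≤ 2 ^ (4 * inputLength n p ε) := Nat.one_le_two_pow
  have hN : inputLength n p ε = n + p.size + ε.num.toNat.size + ε.den.size := rfl
  refine ⟨?_, fun x => ?_, fun a i => ?_⟩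
  · exact le_trans (by norm_num) (Nat.pow_le_pow_right (by omega)
      (show 1 ≤ 4 * inputLength n p ε by omega))
  · match x with
    | 0 => exact key n n Nat.lt_two_pow_self (by omega)
    | 1 => exact key r n (r.2.trans Nat.lt_two_pow_self) (by omega)
    | 2 => exact key p _ (Nat.lt_size_self p) (by omega)
    | 3 => exact key _ _ (Nat.lt_size_self ε.num.toNat) (by omega)
    | 4 => exact key _ _ (Nat.lt_size_self ε.den) (by omega)
    | _ + 5 => exact Nat.zero_le _
  · match a with
    | 0 => simp only [inputStore]; split_ifs <;> omega
    | 1 => simp only [inputStore]; split_ifs <;> omega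
    | _ + 2 => exact Nat.zero_le _

theorem inputStore_hasInput {n : ℕ} (G : Digraph (Fin n)) (R : Finset (Fin n)) (r : Fin n)
    (p : ℕ) (ε : ℚ) : RAM.HasInput G r R ε.num.toNat ε.den p (inputStore G R r p ε) where
  graph := by
    refine ⟨rfl, rfl, fun u v => ?_⟩
    simp only [inputStore, ne_eq, ite_eq_right_iff, one_ne_zero, imp_false, not_not]
    constructor
    · rintro ⟨u', v', h, ha⟩
      obtain ⟨rfl, rfl⟩ := RAM.pair_inj h
      exact ha
    · exact fun ha => ⟨u, v, rfl, ha⟩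
  terminals u := by
    simp only [inputStore]
    congr 1
    exact propext ⟨fun ⟨v, hv, h⟩ => Fin.ext h ▸ hv, fun hu => ⟨u, hu, rfl⟩⟩
  bound := rfl
  num := rfl
  den := rfl

/-- The exponential factor of the running time. -/
theorem exists_exponential_bound {p a b : ℕ} (ha : 0 < a) (hb : 0 < b) :
    ∃ E : ℕ, (∀ k, 2 * k * a ≤ p * p * b → (2 ^ k) ^ 2 ≤ E) ∧
      (E : ℝ) ≤ (2 : ℝ) ^ ((p : ℝ) ^ 2 / ((a : ℝ) / b)) := by
  -- The exponent may be rounded down, as 2k is an integer.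
  refine ⟨2 ^ (p * p * b / a), fun k hk => ?_, ?_⟩
  · rw [← pow_mul]
    refine Nat.pow_le_pow_right (by omega) ?_
    rw [Nat.le_div_iff_mul_le ha]
    linarith [mul_comm 2 k]
  · rw [Nat.cast_pow, Nat.cast_ofNat, ← Real.rpow_natCast]
    refine Real.rpow_le_rpow_of_exponent_le (by norm_num) ?_
    refine Nat.cast_div_le.trans (le_of_eq ?_)
    push_cast
    have : (a : ℝ) ≠ 0 := by positivity
    have : (b : ℝ) ≠ 0 := by positivity
    field_simp

theorem theorem2 :
    ∃ (c : RAM.Program) (C d : ℕ),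
      ∀ (n : ℕ) (G : Digraph (Fin n)) (R : Finset (Fin n)) (r : Fin n), r ∈ R →
      ∀ (p : ℕ) (ε : ℚ), 0 < ε →
        ∃ (s : RAM.Store) (t tbit : ℕ),
          RAM.Runs RAM.unitPrice c (inputStore G R r p ε) t s ∧
          (t : ℝ) ≤ C * (2 : ℝ) ^ ((p : ℝ) ^ 2 / (ε : ℝ)) * (n : ℝ) ^ d ∧
          RAM.Runs RAM.bitPrice c (inputStore G R r p ε) tbit s ∧
          (tbit : ℝ) ≤
            C * (2 : ℝ) ^ ((p : ℝ) ^ 2 / (ε : ℝ)) * (inputLength n p ε : ℝ) ^ d ∧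
          ((∃ T : ArcGraph (Fin n), T.IsSteinerArborescence G R r ∧ T.steinerCount R ≤ p) →
            ∃ T : ArcGraph (Fin n), OutputIs s T ∧ T.IsSteinerArborescence G R r ∧
              ∀ T' : ArcGraph (Fin n), T'.IsSteinerArborescence G R r → T'.steinerCount R ≤ p →
                (T.cost : ℝ) ≤ (1 + (ε : ℝ)) * T'.cost) := by
  -- There are at most 700 n⁶E commands, each charged at most 200 squared prices. In the logarithmic
  -- model the price of M^40 = 2^(160N) is at most 162N, which explains 162² and the degree 6 + 2.
  refine ⟨RAM.solver, 700 * (200 * 162 ^ 2), 8, fun n G R r hr p ε hε => ?_⟩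
  have hn : 1 ≤ n := r.pos
  set N := inputLength n p ε with hN
  have hnN : n ≤ N := by simp only [hN, inputLength]; omega
  have ha : 0 < ε.num.toNat := by have := Rat.num_pos.2 hε; omega
  have hb : 0 < ε.den := ε.den_pos
  have hεab : (ε : ℝ) = (ε.num.toNat : ℝ) / ε.den := by
    have h₁ : ((ε.num.toNat : ℤ) : ℚ) = ε.num := by
      rw [Int.toNat_of_nonneg (Rat.num_pos.2 hε).le]
    have h₂ : ε = (ε.num.toNat : ℚ) / ε.den := by
      rw [← Int.cast_natCast ε.num.toNat, h₁, Rat.num_div_den]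
    have h₃ := congrArg (fun q : ℚ => (q : ℝ)) h₂
    push_cast at h₃
    exact h₃
  obtain ⟨E, hE, hE'⟩ := exists_exponential_bound (p := p) ha hb
  rw [← hεab] at hE'
  -- This is where the 4 in the bound 2^(4N) for stored numbers comes from.
  have hM : n * n * (2 ^ n * 2 ^ n) ≤ 2 ^ (4 * N) := by
    have h₁ : n ≤ 2 ^ n := Nat.lt_two_pow_self.le
    calc n * n * (2 ^ n * 2 ^ n) ≤ 2 ^ n * 2 ^ n * (2 ^ n * 2 ^ n) :=
          Nat.mul_le_mul_right _ (Nat.mul_le_mul h₁ h₁)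
      _ = 2 ^ (4 * n) := by ring
      _ ≤ _ := Nat.pow_le_pow_right (by omega) (by omega)
  obtain ⟨s, -, ⟨T, B, hout, htree, hverts, hinv⟩, hruns⟩ :=
    RAM.solver_spec hr (inputStore_hasInput G R r p ε) hM hE (inputStore_bdd G R r p ε)
  obtain ⟨t, ht, ht'⟩ := hruns RAM.unitPrice (fun _ _ _ => le_rfl) (fun _ => le_rfl)
  obtain ⟨tbit, hb₁, hb₂⟩ := hruns RAM.bitPrice
    (fun _ _ h => Nat.add_le_add_right (Nat.size_le_size h) 1) (fun _ => by simp [RAM.bitPrice])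
  refine ⟨s, t, tbit, ht, ?_, hb₁, ?_, ?_⟩
  · have h₁ : t ≤ 700 * (200 * 162 ^ 2) * E * n ^ 8 := by
      refine ht'.trans ?_
      simp only [RAM.unitPrice]
      have : E * n ^ 6 ≤ E * n ^ 8 :=
        Nat.mul_le_mul_left _ (Nat.pow_le_pow_right hn (by omega))
      calc 700 * n ^ 6 * E * (200 * 1 ^ 2) = 700 * 200 * (E * n ^ 6) := by ring
        _ ≤ 700 * (200 * 162 ^ 2) * (E * n ^ 8) := Nat.mul_le_mul (by norm_num) this
        _ = _ := by ring
    calc (t : ℝ) ≤ ((700 * (200 * 162 ^ 2) * E * n ^ 8 : ℕ) : ℝ) := by exact_mod_cast h₁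
      _ = ((700 * (200 * 162 ^ 2) : ℕ) : ℝ) * E * (n : ℝ) ^ 8 := by push_cast; ring
      _ ≤ _ := by gcongr
  · have h₀ : RAM.bitPrice ((2 ^ (4 * N)) ^ 40) ≤ 162 * N := by
      have := RAM.size_le_of_le_two_pow (m := (2 ^ (4 * N)) ^ 40) (k := 160 * N)
        (by rw [← pow_mul]; exact Nat.pow_le_pow_right (by omega) (by omega))
      simp only [RAM.bitPrice]; omega
    have h₁ : tbit ≤ 700 * (200 * 162 ^ 2) * E * N ^ 8 := by
      calc tbit ≤ 700 * n ^ 6 * E * (200 * RAM.bitPrice ((2 ^ (4 * N)) ^ 40) ^ 2) := hb₂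
        _ ≤ 700 * N ^ 6 * E * (200 * (162 * N) ^ 2) := by gcongr
        _ = _ := by ring
    calc (tbit : ℝ) ≤ ((700 * (200 * 162 ^ 2) * E * N ^ 8 : ℕ) : ℝ) := by exact_mod_cast h₁
      _ = ((700 * (200 * 162 ^ 2) : ℕ) : ℝ) * E * (N : ℝ) ^ 8 := by push_cast; ring
      _ ≤ _ := by gcongr
  · rintro ⟨T₀, hT₀, -⟩
    refine ⟨T, hout, ⟨htree.subgraph, htree.arborescence, fun t htR => ?_⟩, fun T' hT' hp' => ?_⟩
    -- The given solution only serves to show that all terminals are reachable in `G`.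
    · exact (hverts t).2 (hinv.feasible t htR
        ((hT₀.reachIn t (hT₀.terminals htR)).mono (Finset.subset_univ _)))
    · have h₁ : T.verts.card ≤ B.card := Finset.card_le_card fun v hv => by
        rcases (htree.reach v hv).mem with h | h
        · rw [h]; exact hinv.sub hr
        · exact h
      have h₂ := hinv.card_le hr hT' hp'
      have h₃ := hT'.arborescence.card_verts_le
      have h₄ : T.cost + 1 = T.verts.card := htree.card
      -- Passing from vertices to arcs removes b on the left and b + a on the right; the extra `a`
      -- carried along since the greedy phase makes up the difference.
      have h₅ : T.cost * ε.den ≤ T'.cost * (ε.den + ε.num.toNat) := by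
        have h₆ : (T.cost + 1) * ε.den ≤ B.card * ε.den :=
          Nat.mul_le_mul_right _ (h₄.trans_le h₁)
        have h₇ : T'.verts.card * (ε.den + ε.num.toNat) ≤
            (T'.cost + 1) * (ε.den + ε.num.toNat) := Nat.mul_le_mul_right _ h₃
        rw [add_mul] at h₆ h₇
        omega
      have h₈ : (T.cost : ℝ) * ε.den ≤ T'.cost * (ε.den + ε.num.toNat) := by exact_mod_cast h₅
      have hb' : (0 : ℝ) < ε.den := by exact_mod_cast hb
      rw [hεab]
      refine le_of_mul_le_mul_right (h₈.trans (le_of_eq ?_)) hb'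
      field_simp
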